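/- Let $L$, $A_1,A_2,\dots$ and $U_1,U_2,\dots$ be non-negative random variables on a probability space such that $(A_i)_{i\ge1}$ and $(U_i)_{i\ge1}$ are two i.i.d. sequences and $L$, $(A_i)_{i\ge1}$, $(U_i)_{i\ge1}$ are mutually independent; write $A$ and $U$ for random variables distributed as $A_1$ and $U_1$, with $A$ and $U$ independent. Let $$N=\inf\{n\ge 1: A_n\ge L\},\qquad T=\sum_{i=1}^{N-1}(A_i+U_i)+L$$ be the number of transmissions and the total transmission time (with $T=\infty$ if $N=\infty$), and let $\bar F(x)=\mathbb P[L>x]$, $\bar G(x)=\mathbb P[A>x]$. Assume that $\bar F$ is continuous on $[0,\infty)$ and that $\bar F(x)>0$ for all $x\ge 0$. Let $\alpha>0$ and let $\Phi$ be regularly varying at infinity with index $\alpha$, i.e. $\Phi$ is measurable, eventually positive, and $\Phi(cx)/\Phi(x)\to c^{\alpha}$ as $x\to\infty$ for every $c>0$. Suppose that, as $x\to\infty$, $$\frac1{\bar F(x)}\sim \Phi\!\left(\frac1{\bar G(x)}\right),$$ and that for some $\theta>0$ $$\mathbb E\big[U^{\max(\alpha,1)+\theta}\big]<\infty,\qquad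 \mathbb E\big[A^{1+\theta}\big]<\infty,\qquad \mathbb E\big[L^{\alpha+\theta}\big]<\infty .$$ Then, as $t\to\infty$, $$\mathbb P[T>t]\sim\frac{\Gamma(\alpha+1)\,(\mathbb E[U+A])^{\alpha}}{\Phi(t)} .$$ Here $a(t)\sim b(t)$ means $a(t)/b(t)\to1$. -/

import Mathlib

open MeasureTheory ProbabilityTheory Filter Topology Set

namespace Retransmission

/-- Regular variation at infinity with index `α`. Functions on `(0, ∞)` are represented by
functions on `ℝ`, whose values on `(-∞, 0]` play no role (extend by zero, say). -/
structure IsRegularlyVarying (Φ : ℝ → ℝ) (α : ℝ) : Prop where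
  measurable : Measurable Φ
  eventually_pos : ∀ᶠ x in atTop, 0 < Φ x
  tendsto_ratio : ∀ c : ℝ, 0 < c → Tendsto (fun x => Φ (c * x) / Φ x) atTop (𝓝 (c ^ α))

variable {Ω : Type*}

/-- The complementary cumulative distribution function `x ↦ ℙ[X > x]`. -/
noncomputable def ccdf [MeasurableSpace Ω] (P : Measure Ω) (X : Ω → ℝ) (x : ℝ) : ℝ :=
  P.real {ω | x < X ω}

/-- The number of transmissions `N = inf {n ≥ 1 : A_n ≥ L}`. Sequences are indexed from `0`,
that is, `A i` is the length of the `(i+1)`-st available period.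
The infimum of the empty set is `⊤`. -/
noncomputable def numTransmissions (A : ℕ → Ω → ℝ) (L : Ω → ℝ) (ω : Ω) : ℕ∞ :=
  sInf {n : ℕ∞ | ∃ i : ℕ, n = (i : ℕ∞) + 1 ∧ L ω ≤ A i ω}

open Classical in
/-- The total transmission time, the sum of `A_i + U_i` over the `N - 1` failed attempts, plus `L`;
it is infinite if no attempt succeeds. -/
noncomputable def totalTime (A U : ℕ → Ω → ℝ) (L : Ω → ℝ) (ω : Ω) : EReal :=
  if numTransmissions A L ω = ⊤ then ⊤
  else (((∑ i ∈ Finset.range ((numTransmissions A L ω).toNat - 1), (A i ω + U i ω)) + L ω : ℝ) :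
    EReal)

end Retransmission

/-! Given `L`, the attempts fail independently, each with probability 1 - p(L), where p(x) = ℙ[A ≥
x]. Hence the first n attempts all fail with probability 𝔼[(1 - p(L))^n], which depends only on the
law of p(L) near 0. Continuity of the tail of `L` turns the hypothesis on `Φ` into ℙ[p(L) ≤ 1/s] ∼
1/Φ(s) (`tendsto_mul_prob_le`), and an Abelian argument gives ℙ[N > n] ∼ Γ(α+1)/Φ(n)
(`tendsto_mul_integral_one_sub_pow`).

With m = 𝔼[A + U], a run of n failures lasts about nm, so T > t should mean N > t/m, and regular
variation produces the factor m^α. What remains is to show that every deviation from this picture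
has probability o(1/Φ(t)).

For the lower bound, sums of non-negative variables fall below their mean only with exponentially
small probability, so about (1+ε)t/m failures force T > t.

For the upper bound take n ≈ (1-ε)t/m. If T > t and some attempt among the first n succeeds, then
`L` exceeds δt, or some U_i exceeds δt after i failures, or a sum truncated at δt exceeds its mean
by a multiple of t (`lt_totalTime_cases`). Failed periods satisfy A_i < L, so the moment of `L`
controls large values of `A`, and 1+θ moments of `A` suffice. A large U_i counts only if the
attempts before it failed; summing those probabilities costs about t^(1 - min(α,1)), which the
moment of order max(α,1)+θ absorbs. Truncated sums are handled by a Chernoff bound with parameter of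
order log t / t. -/

namespace Retransmission

/-! ### Regular variation: uniform convergence and Potter's bounds -/

/-- **Uniform convergence theorem** (additive form). -/
theorem uniform_convergence_additive {h : ℝ → ℝ} (hm : Measurable h)
    (hlim : ∀ c, Tendsto (fun x => h (x + c) - h x) atTop (𝓝 0)) {B : ℝ} (hB : 0 ≤ B)
    {ε : ℝ} (hε : 0 < ε) :
    ∀ᶠ x in atTop, ∀ u ∈ Icc 0 B, |h (x + u) - h x| < ε := by
  by_contra hcon
  obtain ⟨x, hx, hxu⟩ := exists_seq_forall_of_frequently (not_eventually.1 hcon)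
  push Not at hxu
  choose u hu hge using hxu
  have key : ∀ y : ℕ → ℝ, Tendsto y atTop atTop →
      ∀ᶠ n in atTop, volume.restrict (Icc 0 (2 * B + 1))
        {c | ε / 2 ≤ |h (y n + c) - h (y n)|} < ENNReal.ofReal (1 / 2) := by
    intro y hy
    have hT : TendstoInMeasure (volume.restrict (Icc 0 (2 * B + 1)))
        (fun n c => h (y n + c) - h (y n)) atTop (fun _ => (0 : ℝ)) := by
      apply tendstoInMeasure_of_tendsto_ae
      · intro n
        exact ((hm.comp (measurable_const_add _)).sub_const _).aestronglyMeasurable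
      · exact Eventually.of_forall fun c => (hlim c).comp hy
    have := tendstoInMeasure_iff_norm.1 hT (ε / 2) (by positivity)
    simpa using this.eventually_lt_const (u := ENNReal.ofReal (1 / 2)) (by simp)
  have hxu' : Tendsto (fun n => x n + u n) atTop atTop :=
    tendsto_atTop_mono (fun n => by linarith [(hu n).1]) hx
  obtain ⟨n, h1, h2⟩ := ((key x hx).and (key _ hxu')).exists
  have hm1 : ∀ y, MeasurableSet {c | ε / 2 ≤ |h (y + c) - h y|} := fun y =>
    measurableSet_le measurable_const
      (continuous_abs.measurable.comp ((hm.comp (measurable_const_add y)).sub_const _))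
  rw [Measure.restrict_apply (hm1 _)] at h1 h2
  set F := {c | ε / 2 ≤ |h (x n + c) - h (x n)|} ∩ Icc 0 (2 * B + 1)
  set G := {c | ε / 2 ≤ |h (x n + u n + c) - h (x n + u n)|} ∩ Icc 0 (2 * B + 1)
  -- A point reached with small increment from both x_n and x_n + u_n would make h(x_n + u_n) -
  -- h(x_n) smaller than ε. So a window of length B + 1 ≥ 1 is covered by two sets of measure below
  -- 1/2.
  have hsub : Icc B (2 * B + 1) ⊆ F ∪ (fun c => c + -u n) ⁻¹' G := by
    intro c hc
    by_contra hn
    rw [mem_union, not_or] at hn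
    have hc1 : c ∈ Icc 0 (2 * B + 1) := ⟨hB.trans hc.1, hc.2⟩
    have hc2 : c + -u n ∈ Icc 0 (2 * B + 1) :=
      ⟨by linarith [(hu n).2, hc.1], by linarith [(hu n).1, hc.2]⟩
    have a1 : ¬ ε / 2 ≤ |h (x n + c) - h (x n)| := fun hh => hn.1 ⟨hh, hc1⟩
    have a2 : ¬ ε / 2 ≤ |h (x n + u n + (c + -u n)) - h (x n + u n)| := fun hh => hn.2 ⟨hh, hc2⟩
    have e : x n + u n + (c + -u n) = x n + c := by ring
    rw [e] at a2
    rw [not_le, abs_lt] at a1 a2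
    have := hge n
    rw [le_abs] at this
    rcases this with h' | h' <;> linarith [a1.1, a1.2, a2.1, a2.2]
  have hv := (measure_mono hsub).trans (measure_union_le (μ := volume) _ _)
  rw [measure_preimage_add_right, Real.volume_Icc] at hv
  have := hv.trans_lt (ENNReal.add_lt_add h1 h2)
  rw [← ENNReal.ofReal_add (by norm_num) (by norm_num), ENNReal.ofReal_lt_ofReal_iff (by norm_num)]
    at this
  linarith

namespace IsRegularlyVarying

variable {Φ : ℝ → ℝ} {α : ℝ}

/-- **Uniform convergence theorem** for regularly varying functions. -/
theorem uniform_convergence (hΦ : IsRegularlyVarying Φ α) {Λ : ℝ} (hΛ : 1 ≤ Λ) {ε : ℝ}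
    (hε : 0 < ε) :
    ∀ᶠ u in atTop, ∀ l ∈ Icc 1 Λ, |Φ (l * u) / (l ^ α * Φ u) - 1| < ε := by
  -- Logarithmic coordinates, with the index removed, reduce the claim to the additive form.
  set h : ℝ → ℝ := fun x => Real.log (Φ (Real.exp x)) - α * x with hh
  have hm : Measurable h :=
    (Real.measurable_log.comp (hΦ.measurable.comp Real.measurable_exp)).sub
      (measurable_const.mul measurable_id)
  obtain ⟨X, hX⟩ := eventually_atTop.1 (Real.tendsto_exp_atTop.eventually hΦ.eventually_pos)
  have hlim : ∀ c, Tendsto (fun x => h (x + c) - h x) atTop (𝓝 0) := by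
    intro c
    have h1 := (hΦ.tendsto_ratio (Real.exp c) (Real.exp_pos c)).comp Real.tendsto_exp_atTop
    have h2 := (h1.log (by positivity)).sub_const (α * c)
    rw [Real.log_rpow (Real.exp_pos c), Real.log_exp, sub_self] at h2
    refine h2.congr' ?_
    filter_upwards [eventually_ge_atTop X, eventually_ge_atTop (X - c)] with x h3 h4
    have p1 := hX x h3
    have p2 := hX (x + c) (by linarith)
    simp only [Function.comp, hh]
    rw [← Real.exp_add, add_comm c x, Real.log_div p2.ne' p1.ne']
    ring
  obtain ⟨δ, hδ, hδε⟩ := Metric.continuousAt_iff.1 (Real.continuous_exp.continuousAt (x := 0)) ε hε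
  have hu := uniform_convergence_additive hm hlim (B := Real.log Λ) (Real.log_nonneg hΛ) hδ
  filter_upwards [Real.tendsto_log_atTop.eventually hu, eventually_gt_atTop 0,
    Real.tendsto_log_atTop.eventually (eventually_ge_atTop X)] with u h1 hu0 hX' l hl
  have hl0 : 0 < l := by linarith [hl.1]
  have h2 := h1 (Real.log l) ⟨Real.log_nonneg hl.1, Real.log_le_log hl0 hl.2⟩
  have p1 := hX _ hX'
  have p2 := hX (Real.log u + Real.log l) (by linarith [Real.log_nonneg hl.1])
  have := @hδε (h (Real.log u + Real.log l) - h (Real.log u)) (by simpa [Real.dist_eq] using h2)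
  rw [Real.dist_eq, Real.exp_zero] at this
  convert this using 3
  rw [Real.exp_add, Real.exp_log hu0, Real.exp_log hl0, mul_comm] at p2
  rw [Real.exp_log hu0] at p1
  simp only [hh]
  rw [Real.exp_add, Real.exp_log hu0, Real.exp_log hl0, mul_comm u l,
    show Real.log (Φ (l * u)) - α * (Real.log u + Real.log l) -
      (Real.log (Φ u) - α * Real.log u) = Real.log (Φ (l * u)) - (Real.log l * α + Real.log (Φ u))
      by ring, Real.exp_sub, Real.exp_add, Real.exp_log p2, Real.exp_log p1,
    Real.rpow_def_of_pos hl0]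

theorem tendsto_ratio_of_tendsto (hΦ : IsRegularlyVarying Φ α) {ι : Type*} {f : Filter ι}
    {s u : ι → ℝ} {c : ℝ} (hc : 0 < c) (hs : Tendsto s f atTop)
    (hus : Tendsto (fun i => u i / s i) f (𝓝 c)) :
    Tendsto (fun i => Φ (u i) / Φ (s i)) f (𝓝 (c ^ α)) := by
  -- The multiplier u/s varies, so uniformity is needed. Rescaling the base to c/2 · s makes the
  -- multiplier tend to 2, inside the interval [1, 4].
  have hs' : Tendsto (fun i => c / 2 * s i) f atTop := hs.const_mul_atTop (by positivity)
  have hl : Tendsto (fun i => u i / (c / 2 * s i)) f (𝓝 2) := by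
    have := hus.div_const (c / 2)
    rw [show c / (c / 2) = 2 by field_simp] at this
    refine this.congr fun i => ?_
    rw [div_div, mul_comm (s i)]
  have hlα : Tendsto (fun i => (u i / (c / 2 * s i)) ^ α) f (𝓝 (2 ^ α)) :=
    hl.rpow_const (Or.inl (by norm_num))
  have h1 : Tendsto (fun i => Φ (u i) / ((u i / (c / 2 * s i)) ^ α * Φ (c / 2 * s i))) f
      (𝓝 1) := by
    rw [Metric.tendsto_nhds]
    intro ε hε
    filter_upwards [hs'.eventually (hΦ.uniform_convergence (Λ := 4) (by norm_num) hε),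
      hs'.eventually (eventually_gt_atTop 0), hl.eventually (Icc_mem_nhds (a := 1) (b := 4)
        (by norm_num) (by norm_num))] with i h1 h2 h3
    have := h1 _ h3
    rwa [div_mul_cancel₀ _ h2.ne'] at this
  have h2 : Tendsto (fun i => Φ (c / 2 * s i) / Φ (s i)) f (𝓝 ((c / 2) ^ α)) :=
    (hΦ.tendsto_ratio (c / 2) (by positivity)).comp hs
  have := (h1.mul hlα).mul h2
  rw [one_mul, ← Real.mul_rpow (by norm_num) (by positivity), show 2 * (c / 2) = c by ring] at this
  refine this.congr' ?_
  filter_upwards [hs'.eventually hΦ.eventually_pos, hl.eventually (lt_mem_nhds (a := 0)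
    (by norm_num))] with i h3 h4
  have := (Real.rpow_pos_of_pos h4 α).ne'
  have := h3.ne'
  generalize (u i / (c / 2 * s i)) ^ α = a at *
  generalize Φ (c / 2 * s i) = b at *
  field_simp

/-- A function of positive index is almost increasing. -/
theorem almost_monotone (hΦ : IsRegularlyVarying Φ α) (hα : 0 < α) {ε : ℝ} (hε : 0 < ε) :
    ∃ u₀, 0 < u₀ ∧ ∀ u v, u₀ ≤ u → u ≤ v → 0 < Φ u ∧ Φ u ≤ (1 + ε) * Φ v := by
  -- One step by Λ multiplies `Φ` by at least 4(1 - η) ≥ 2, so nothing is lost over any number of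
  -- steps. Only the last, partial step costs a factor 1 - η ≥ 1/(1 + ε).
  set Λ : ℝ := 4 ^ (1 / α)
  have hΛ : 1 < Λ := Real.one_lt_rpow (by norm_num) (by positivity)
  have hΛα : Λ ^ α = 4 := by
    rw [← Real.rpow_mul (by norm_num), one_div_mul_cancel hα.ne', Real.rpow_one]
  set η : ℝ := min (1 / 2) (1 - 1 / (1 + ε))
  have hη : 0 < η := by
    refine lt_min (by norm_num) ?_
    rw [sub_pos, div_lt_one (by positivity)]; linarith
  obtain ⟨u₀, h⟩ := eventually_atTop.1 (((hΦ.uniform_convergence hΛ.le hη).and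
    hΦ.eventually_pos).and (eventually_gt_atTop 0))
  have hstep : ∀ u, u₀ ≤ u → ∀ l ∈ Icc 1 Λ, l ^ α * Φ u * (1 - η) ≤ Φ (l * u) := by
    intro u hu l hl
    obtain ⟨⟨h1, h2⟩, h3⟩ := h u hu
    have h4 := (abs_lt.1 (h1 l hl)).1
    have hp : 0 < l ^ α * Φ u := mul_pos (Real.rpow_pos_of_pos (by linarith [hl.1]) _) h2
    have : 1 - η ≤ Φ (l * u) / (l ^ α * Φ u) := by linarith
    rw [le_div_iff₀ hp] at this
    linarith
  have hpow : ∀ k : ℕ, ∀ u, u₀ ≤ u → Φ u ≤ Φ (Λ ^ k * u) ∧ u₀ ≤ Λ ^ k * u := by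
    intro k
    induction k with
    | zero => intro u hu; simp [hu]
    | succ k ih =>
      intro u hu
      obtain ⟨h1, h2⟩ := ih u hu
      have h3 := hstep _ h2 Λ ⟨hΛ.le, le_rfl⟩
      have h4 := (h _ h2).1.2
      have h5 : η ≤ 1 / 2 := min_le_left _ _
      have h0 := (h _ h2).2
      rw [hΛα] at h3
      rw [pow_succ', mul_assoc]
      constructor
      · nlinarith
      · nlinarith
  refine ⟨u₀, (h u₀ le_rfl).2, fun u v hu huv => ⟨(h u hu).1.2, ?_⟩⟩
  have hu0 := (h u hu).2
  obtain ⟨k, hk1, hk2⟩ := exists_nat_pow_near (x := v / u) (y := Λ)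
    (by rwa [one_le_div hu0]) hΛ
  have hΛk : (0 : ℝ) < Λ ^ k := by positivity
  obtain ⟨h1, h2⟩ := hpow k u hu
  have hl : v / u / Λ ^ k ∈ Icc 1 Λ := by
    constructor
    · rwa [one_le_div hΛk]
    · rw [div_le_iff₀ hΛk, ← pow_succ']; exact hk2.le
  have h3 := hstep _ h2 _ hl
  have e : v / u / Λ ^ k * (Λ ^ k * u) = v := by field_simp
  rw [e] at h3
  have h4 : 1 ≤ (v / u / Λ ^ k) ^ α := Real.one_le_rpow hl.1 hα.le
  have h5 : η ≤ 1 - 1 / (1 + ε) := min_le_right _ _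
  have h6 := (h _ h2).1.2
  have h7 : 1 / (1 + ε) ≤ 1 - η := by linarith
  have h8 : Φ u * (1 / (1 + ε)) ≤ Φ v := by
    calc Φ u * (1 / (1 + ε)) ≤ Φ (Λ ^ k * u) * (1 - η) := by
          apply mul_le_mul h1 h7 (by positivity) h6.le
      _ ≤ (v / u / Λ ^ k) ^ α * Φ (Λ ^ k * u) * (1 - η) := by
          apply mul_le_mul_of_nonneg_right _ (le_trans (by positivity) h7)
          nlinarith
      _ ≤ Φ v := h3
  rw [mul_one_div, div_le_iff₀ (by positivity)] at h8
  linarith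

theorem inv (hΦ : IsRegularlyVarying Φ α) : IsRegularlyVarying (fun x => (Φ x)⁻¹) (-α) where
  measurable := hΦ.measurable.inv
  eventually_pos := hΦ.eventually_pos.mono fun _ h => inv_pos.2 h
  tendsto_ratio c hc := by
    have := (hΦ.tendsto_ratio c hc).inv₀ (by positivity)
    rw [← Real.rpow_neg hc.le] at this
    refine this.congr fun x => ?_
    rw [inv_div_inv, inv_div]

theorem mul_rpow (hΦ : IsRegularlyVarying Φ α) (β : ℝ) :
    IsRegularlyVarying (fun x => Φ x * x ^ β) (α + β) where
  measurable := hΦ.measurable.mul (measurable_id.pow_const β)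
  eventually_pos := by
    filter_upwards [hΦ.eventually_pos, eventually_gt_atTop 0] with x h1 h2
    positivity
  tendsto_ratio c hc := by
    have := (hΦ.tendsto_ratio c hc).mul_const (c ^ β)
    rw [← Real.rpow_add hc] at this
    refine this.congr' ?_
    filter_upwards [hΦ.eventually_pos, eventually_gt_atTop 0] with x h1 h2
    rw [Real.mul_rpow hc.le h2.le]
    have := (Real.rpow_pos_of_pos h2 β).ne'
    field_simp

/-- **Potter's bounds**. -/
theorem potter (hΦ : IsRegularlyVarying Φ α) {η : ℝ} (hη : 0 < η) :
    ∃ u₀, 0 < u₀ ∧ ∀ u v, u₀ ≤ u → u ≤ v → 0 < Φ u ∧ 0 < Φ v ∧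
      Φ v ≤ 2 * (v / u) ^ (α + η) * Φ u ∧ (v / u) ^ (α - η) * Φ u ≤ 2 * Φ v := by
  -- Both auxiliary functions, x^(α+η)/Φ(x) and Φ(x)·x^(-(α-η)), have index η > 0; their almost
  -- monotonicity is the two bounds.
  obtain ⟨a, ha, h1⟩ := (hΦ.inv.mul_rpow (α + η)).almost_monotone (by linarith) one_pos
  obtain ⟨b, hb, h2⟩ := (hΦ.mul_rpow (-(α - η))).almost_monotone (by linarith) one_pos
  obtain ⟨c, h3⟩ := eventually_atTop.1 hΦ.eventually_pos
  refine ⟨max a (max b c), by positivity, fun u v hu huv => ?_⟩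
  have hua : a ≤ u := (le_max_left _ _).trans hu
  have hub : b ≤ u := (le_max_left _ _).trans ((le_max_right _ _).trans hu)
  have huc : c ≤ u := (le_max_right _ _).trans ((le_max_right _ _).trans hu)
  have hu0 : 0 < u := by linarith
  have hv0 : 0 < v := by linarith
  have pu := h3 u huc
  have pv := h3 v (huc.trans huv)
  refine ⟨pu, pv, ?_, ?_⟩
  · have := (h1 u v hua huv).2
    rw [Real.div_rpow hv0.le hu0.le]
    have q1 := Real.rpow_pos_of_pos hu0 (α + η)
    have q2 := Real.rpow_pos_of_pos hv0 (α + η)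
    field_simp at this ⊢
    linarith
  · have := (h2 u v hub huv).2
    rw [Real.div_rpow hv0.le hu0.le]
    rw [Real.rpow_neg hu0.le, Real.rpow_neg hv0.le] at this
    have q1 := Real.rpow_pos_of_pos hu0 (α - η)
    have q2 := Real.rpow_pos_of_pos hv0 (α - η)
    field_simp at this ⊢
    linarith

theorem eventually_le_rpow (hΦ : IsRegularlyVarying Φ α) {η : ℝ} (hη : 0 < η) :
    ∃ C, 0 < C ∧ ∀ᶠ t in atTop, 0 < Φ t ∧ Φ t ≤ C * t ^ (α + η) := by
  obtain ⟨u₀, hu₀, h⟩ := hΦ.potter hη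
  have h0 := (h u₀ u₀ le_rfl le_rfl).1
  refine ⟨2 * Φ u₀ / u₀ ^ (α + η), by positivity, ?_⟩
  filter_upwards [eventually_ge_atTop u₀] with t ht
  have := h u₀ t le_rfl ht
  refine ⟨this.2.1, this.2.2.1.trans (le_of_eq ?_)⟩
  rw [Real.div_rpow (hu₀.le.trans ht) hu₀.le]
  ring

/-- Quantities that are `O(t ^ (-β))` with `β > α` are negligible against `1 / Φ t`. -/
theorem tendsto_mul_of_le_rpow (hΦ : IsRegularlyVarying Φ α) {β C : ℝ} (hβ : α < β) {f : ℝ → ℝ}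
    (hf0 : ∀ t, 0 ≤ f t) (hf : ∀ᶠ t in atTop, f t ≤ C * t ^ (-β)) :
    Tendsto (fun t => Φ t * f t) atTop (𝓝 0) := by
  obtain ⟨D, hD, h⟩ := hΦ.eventually_le_rpow (η := (β - α) / 2) (by linarith)
  have hz : Tendsto (fun t : ℝ => D * C * t ^ (-((β - α) / 2))) atTop (𝓝 0) := by
    simpa using (tendsto_rpow_neg_atTop (y := (β - α) / 2) (by linarith)).const_mul (D * C)
  refine squeeze_zero' ?_ ?_ hz
  · filter_upwards [hΦ.eventually_pos] with t ht using mul_nonneg ht.le (hf0 t)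
  · filter_upwards [h, hf, eventually_gt_atTop 0] with t h1 h2 h3
    calc Φ t * f t ≤ (D * t ^ (α + (β - α) / 2)) * (C * t ^ (-β)) :=
          mul_le_mul h1.2 h2 (hf0 t) (h1.1.le.trans h1.2)
      _ = D * C * (t ^ (α + (β - α) / 2) * t ^ (-β)) := by ring
      _ = _ := by rw [← Real.rpow_add h3]; congr 2; ring

end IsRegularlyVarying

/-- The square allows for two losses of 1 + ε: one from almost monotonicity, one from the asymptotic
equivalence. -/
theorem tendsto_one_of_forall_le_sq {ι : Type*} {l : Filter ι} {f : ι → ℝ}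
    (h : ∀ ε > 0, ∀ᶠ i in l, f i ≤ (1 + ε) ^ 2 ∧ 1 ≤ (1 + ε) ^ 2 * f i) :
    Tendsto f l (𝓝 1) := by
  have hc : ContinuousAt (fun ε : ℝ => (1 + ε) ^ 2) 0 := by fun_prop
  have hc' : ContinuousAt (fun ε : ℝ => ((1 + ε) ^ 2)⁻¹) 0 :=
    hc.inv₀ (by norm_num)
  refine tendsto_order.2 ⟨fun a ha => ?_, fun b hb => ?_⟩
  · have h1 : ∀ᶠ ε in 𝓝[>] (0 : ℝ), a < ((1 + ε) ^ 2)⁻¹ :=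
      nhdsWithin_le_nhds (hc'.eventually_const_lt (by simpa using ha))
    obtain ⟨ε, h2, h3⟩ := (h1.and self_mem_nhdsWithin).exists
    filter_upwards [h ε h3] with i hi
    have h3' : 0 < ε := h3
    refine h2.trans_le ?_
    rw [inv_le_iff_one_le_mul₀' (by positivity)]
    exact hi.2
  · have h1 : ∀ᶠ ε in 𝓝[>] (0 : ℝ), (1 + ε) ^ 2 < b :=
      nhdsWithin_le_nhds (hc.eventually_lt_const (by simpa using hb))
    obtain ⟨ε, h2, h3⟩ := (h1.and self_mem_nhdsWithin).exists
    filter_upwards [h ε h3] with i hi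
    exact hi.1.trans_lt h2

/-! ### The law of the success probability near 0 -/

section Ccdf

variable {Ω : Type*} [MeasurableSpace Ω] {P : Measure Ω} [IsProbabilityMeasure P]

theorem ccdf_antitone (X : Ω → ℝ) : Antitone (ccdf P X) := fun _ _ h =>
  measureReal_mono (fun _ hω => h.trans_lt hω)

theorem tendsto_ccdf_atTop {X : Ω → ℝ} (hX : Measurable X) :
    Tendsto (ccdf P X) atTop (𝓝 0) := by
  have : IsProbabilityMeasure (P.map X) := Measure.isProbabilityMeasure_map hX.aemeasurable
  have h := (tendsto_cdf_atTop (P.map X)).const_sub 1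
  rw [sub_self] at h
  refine h.congr fun x => ?_
  rw [cdf_eq_real, ← probReal_compl_eq_one_sub measurableSet_Iic,
    map_measureReal_apply hX measurableSet_Iic.compl]
  simp only [ccdf]
  congr 1
  ext ω
  simp

/-- The tail of the attempt success probability: if `1 / ℙ[L > x] ∼ Φ (1 / ℙ[X > x])` then
`ℙ[p(L) ≤ 1 / s] ∼ 1 / Φ s` with `p x = ℙ[X ≥ x]`. -/
theorem tendsto_mul_prob_le {X L : Ω → ℝ} (hX : Measurable X)
    (hL_cont : ContinuousOn (ccdf P L) (Ici 0)) (hL_supp : ∀ x, 0 ≤ x → 0 < ccdf P L x)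
    {Φ : ℝ → ℝ} {α : ℝ} (hα : 0 < α) (hΦ : IsRegularlyVarying Φ α)
    (hX_supp : ∀ x, 0 < ccdf P X x)
    (hΦ_equiv : Tendsto (fun x => (ccdf P L x)⁻¹ / Φ ((ccdf P X x)⁻¹)) atTop (𝓝 1)) :
    Tendsto (fun s => Φ s * P.real {ω | P.real {ω' | L ω ≤ X ω'} ≤ 1 / s}) atTop (𝓝 1) := by
  have hG0 := tendsto_ccdf_atTop (P := P) hX
  have hGinv : Tendsto (fun x => (ccdf P X x)⁻¹) atTop atTop :=
    tendsto_inv_nhdsGT_zero.comp (tendsto_nhdsWithin_iff.2 ⟨hG0, Eventually.of_forall hX_supp⟩)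
  refine tendsto_one_of_forall_le_sq fun ε hε => ?_
  obtain ⟨u₀, hu₀, hmono⟩ := hΦ.almost_monotone hα hε
  have h1 : ∀ᶠ x in atTop, (ccdf P L x)⁻¹ / Φ ((ccdf P X x)⁻¹) < 1 + ε :=
    hΦ_equiv.eventually_lt_const (by linarith)
  have h2 : ∀ᶠ x in atTop, (1 + ε)⁻¹ < (ccdf P L x)⁻¹ / Φ ((ccdf P X x)⁻¹) :=
    hΦ_equiv.eventually_const_lt (inv_lt_one_of_one_lt₀ (by linarith))
  obtain ⟨x₀, hx₀⟩ := eventually_atTop.1 (((h1.and h2).and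
    (hGinv.eventually_ge_atTop u₀)).and (eventually_ge_atTop (0 : ℝ)))
  have hx₀0 : 0 ≤ x₀ := (hx₀ x₀ le_rfl).2
  have hb1 : ∀ x, x₀ ≤ x → (ccdf P L x)⁻¹ ≤ (1 + ε) * Φ ((ccdf P X x)⁻¹) := by
    intro x hx
    obtain ⟨⟨⟨a, b⟩, c⟩, d⟩ := hx₀ x hx
    have hp := (hmono _ _ c le_rfl).1
    rw [div_lt_iff₀ hp] at a
    exact a.le
  have hb2 : ∀ x, x₀ ≤ x → Φ ((ccdf P X x)⁻¹) * ccdf P L x ≤ 1 + ε := by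
    intro x hx
    obtain ⟨⟨⟨a, b⟩, c⟩, d⟩ := hx₀ x hx
    have hp := (hmono _ _ c le_rfl).1
    have hF := hL_supp x d
    rw [inv_eq_one_div, div_lt_div_iff₀ (by positivity) hp] at b
    have := mul_le_mul_of_nonneg_right b.le hF.le
    rw [one_mul, mul_right_comm, inv_mul_cancel₀ hF.ne', one_mul] at this
    exact this
  filter_upwards [eventually_gt_atTop (ccdf P X (x₀ + 1))⁻¹, eventually_gt_atTop (0 : ℝ),
    eventually_ge_atTop u₀] with s hs hs0 hsu
  set H := P.real {ω | P.real {ω' | L ω ≤ X ω'} ≤ 1 / s} with hH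
  have hΦs := (hmono s s hsu le_rfl).1
  have hs1 : 1 / s < ccdf P X (x₀ + 1) := by
    rw [one_div]; exact inv_lt_of_inv_lt₀ (hX_supp _) hs
  have hlow : ∀ x, ccdf P X x ≤ 1 / s → ccdf P L x ≤ H := by
    intro x hx
    refine measureReal_mono fun ω hω => ?_
    have : P.real {ω' | L ω ≤ X ω'} ≤ ccdf P X x :=
      measureReal_mono fun ω' hω' => lt_of_lt_of_le (show x < L ω from hω) hω'
    exact this.trans hx
  have hupp : ∀ x, 1 / s < ccdf P X x → H ≤ ccdf P L x := by
    intro x hx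
    refine measureReal_mono fun ω hω => ?_
    by_contra hn
    have hn' : L ω ≤ x := not_lt.1 hn
    have : ccdf P X x ≤ P.real {ω' | L ω ≤ X ω'} :=
      measureReal_mono fun ω' hω' => hn'.trans (le_of_lt hω')
    have hω' : P.real {ω' | L ω ≤ X ω'} ≤ 1 / s := hω
    linarith
  set S : Set ℝ := {x | x₀ ≤ x ∧ ccdf P X x ≤ 1 / s} with hS
  have hSne : S.Nonempty := by
    have h3 : ∀ᶠ x in atTop, ccdf P X x < 1 / s := hG0.eventually_lt_const (by positivity)
    obtain ⟨x, h4, h5⟩ := (h3.and (eventually_ge_atTop x₀)).exists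
    exact ⟨x, h5, h4.le⟩
  have hSbd : BddBelow S := ⟨x₀, fun x hx => hx.1⟩
  -- A generalized inverse of the tail of `X` at level 1/s. That tail may jump at y, so estimates
  -- are made at points on either side of y and carried to y by continuity of the tail of `L`; in
  -- particular H equals that tail at y.
  set y := sInf S with hy
  have hy1 : x₀ + 1 ≤ y := le_csInf hSne fun x hx => by
    by_contra hn
    have := ccdf_antitone (P := P) X (not_le.1 hn).le
    linarith [hx.2]
  have hgt : ∀ x, y < x → ccdf P X x ≤ 1 / s := by
    intro x hx
    obtain ⟨z, hz, hzx⟩ := exists_lt_of_csInf_lt hSne hx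
    exact (ccdf_antitone X hzx.le).trans hz.2
  have hlt : ∀ x, x₀ ≤ x → x < y → 1 / s < ccdf P X x := by
    intro x hx0 hx
    by_contra hn
    exact absurd (csInf_le hSbd ⟨hx0, not_lt.1 hn⟩) (not_le.2 hx)
  have hcont : ContinuousAt (ccdf P L) y :=
    hL_cont.continuousAt (Ici_mem_nhds (by linarith))
  have hcr : Tendsto (ccdf P L) (𝓝[>] y) (𝓝 (ccdf P L y)) := hcont.tendsto.mono_left nhdsWithin_le_nhds
  have hcl : Tendsto (ccdf P L) (𝓝[<] y) (𝓝 (ccdf P L y)) := hcont.tendsto.mono_left nhdsWithin_le_nhds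
  have hleft : ∀ᶠ x in 𝓝[<] y, x₀ ≤ x ∧ x < y :=
    Eventually.and (nhdsWithin_le_nhds (Ici_mem_nhds (show x₀ < y by linarith)))
      self_mem_nhdsWithin
  have hH1 : ccdf P L y ≤ H :=
    le_of_tendsto hcr (eventually_mem_nhdsWithin.mono fun x hx => hlow x (hgt x hx))
  have hH2 : H ≤ ccdf P L y :=
    ge_of_tendsto hcl (hleft.mono fun x hx => hupp x (hlt x hx.1 hx.2))
  rw [le_antisymm hH2 hH1]
  constructor
  · refine le_of_tendsto (hcr.const_mul (Φ s)) (eventually_mem_nhdsWithin.mono fun x hx => ?_)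
    have hx' : y < x := hx
    have h4 : s ≤ (ccdf P X x)⁻¹ := by
      rw [le_inv_comm₀ hs0 (hX_supp x), ← one_div]; exact hgt x hx
    have h5 := (hmono _ _ hsu h4).2
    have h6 := hb2 x (by linarith)
    have h7 := hL_supp x (by linarith)
    calc Φ s * ccdf P L x ≤ (1 + ε) * Φ ((ccdf P X x)⁻¹) * ccdf P L x :=
          mul_le_mul_of_nonneg_right h5 h7.le
      _ = (1 + ε) * (Φ ((ccdf P X x)⁻¹) * ccdf P L x) := by ring
      _ ≤ (1 + ε) * (1 + ε) := by gcongr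
      _ = _ := by ring
  · refine ge_of_tendsto ((hcl.const_mul (Φ s)).const_mul ((1 + ε) ^ 2)) (hleft.mono fun x hx => ?_)
    have h4 : (ccdf P X x)⁻¹ ≤ s := by
      rw [inv_le_comm₀ (hX_supp x) hs0, ← one_div]; exact (hlt x hx.1 hx.2).le
    have h5 := (hmono _ _ (hx₀ x hx.1).1.2 h4).2
    have h6 := hb1 x hx.1
    have h7 := hL_supp x (by linarith [hx.1])
    have h8 : (ccdf P L x)⁻¹ ≤ (1 + ε) ^ 2 * Φ s := by
      refine h6.trans ?_
      rw [sq, mul_assoc]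
      gcongr
    rw [inv_le_iff_one_le_mul₀ h7] at h8
    linarith

end Ccdf

/-! ### The Abelian theorem for 𝔼[(1 - Y)^n] -/

section Tauberian

variable {Ω : Type*} [MeasurableSpace Ω] {P : Measure Ω} [IsProbabilityMeasure P]

/-- Layer-cake formula with density n·t^(n-1), then t = 1 - z/n. On this scale, after multiplication
by Φ(n), the integrand converges to z^α·e^(-z). -/
theorem integral_one_sub_pow {Y : Ω → ℝ} (hY : Measurable Y) (hY1 : ∀ ω, Y ω ≤ 1) {n : ℕ} (hn : 1 ≤ n) :
    ∫ ω, (1 - Y ω) ^ n ∂P =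
      ∫ z : ℝ, if z < n then P.real {ω | Y ω ≤ z / n} * (1 - z / n) ^ (n - 1) else 0 := by
  have hn0 : (0 : ℝ) < n := by exact_mod_cast hn
  set g : ℝ → ℝ := fun t => n * t ^ (n - 1) with hg
  have hlay := lintegral_comp_eq_lintegral_meas_le_mul (f := fun ω => 1 - Y ω) (g := g) P
    (Eventually.of_forall fun ω => sub_nonneg.2 (hY1 ω)) (hY.const_sub 1).aemeasurable
    (fun t _ => (by fun_prop : Continuous g).intervalIntegrable _ _)
    ((ae_restrict_iff' measurableSet_Ioi).2 (Eventually.of_forall fun t ht => by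
      have : (0 : ℝ) < t := ht
      simp only [hg]; positivity))
  have hprim : ∀ x : ℝ, ∫ t in (0 : ℝ)..x, g t = x ^ n := by
    intro x
    simp only [hg]
    rw [intervalIntegral.integral_const_mul, integral_pow, Nat.sub_add_cancel hn]
    have : ((n - 1 : ℕ) : ℝ) + 1 = n := by exact_mod_cast Nat.sub_add_cancel hn
    rw [this, zero_pow (by lia), sub_zero]
    field_simp
  simp only [hprim] at hlay
  have hmono : Monotone fun y => P.real {ω | Y ω ≤ y} := fun a b hab =>
    measureReal_mono fun ω hω => le_trans hω hab
  set G : ℝ → ℝ := fun t => if 0 < t then P.real {ω | Y ω ≤ 1 - t} * g t else 0 with hG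
  have hreal : ∫ ω, (1 - Y ω) ^ n ∂P = ∫ t, G t := by
    have e : ∫ t, G t = ∫ t in Ioi 0, P.real {ω | Y ω ≤ 1 - t} * g t := by
      rw [← integral_indicator measurableSet_Ioi]
      rfl
    rw [e, integral_eq_lintegral_of_nonneg_ae, integral_eq_lintegral_of_nonneg_ae, hlay]
    · congr 1
      refine setLIntegral_congr_fun measurableSet_Ioi fun t ht => ?_
      rw [ENNReal.ofReal_mul measureReal_nonneg, ofReal_measureReal]
      rw [show {ω | t ≤ 1 - Y ω} = {ω | Y ω ≤ 1 - t} by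
        ext ω; rw [mem_ofPred_eq, mem_ofPred_eq, le_sub_comm]]
    · exact (ae_restrict_iff' measurableSet_Ioi).2 (Eventually.of_forall fun t ht => by
        have : (0 : ℝ) < t := ht
        simp only [hg]
        exact mul_nonneg measureReal_nonneg (by positivity))
    · exact ((hmono.measurable.comp (measurable_const.sub measurable_id)).mul
        (by fun_prop : Continuous g).measurable).aestronglyMeasurable
    · exact Eventually.of_forall fun ω => pow_nonneg (sub_nonneg.2 (hY1 ω)) _
    · exact ((hY.const_sub 1).pow_const n).aestronglyMeasurable
  rw [hreal, ← integral_sub_left_eq_self G volume 1]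
  have h2 := Measure.integral_comp_div (fun y => G (1 - y)) (n : ℝ)
  rw [abs_of_pos hn0, smul_eq_mul] at h2
  rw [← inv_mul_cancel_left₀ hn0.ne' (∫ y, G (1 - y)), ← h2, ← integral_const_mul]
  refine integral_congr_ae (Eventually.of_forall fun z => ?_)
  simp only [hG, sub_pos, div_lt_one hn0, hg]
  split_ifs
  · rw [sub_sub_cancel]; field_simp
  · simp

/-- An Abelian theorem: if `ℙ[Y ≤ 1 / s] ∼ 1 / Φ s` then `𝔼[(1 - Y) ^ n] ∼ Γ(α + 1) / Φ n`. -/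
theorem tendsto_mul_integral_one_sub_pow {Y : Ω → ℝ} (hY : Measurable Y) (hY0 : ∀ ω, 0 < Y ω)
    (hY1 : ∀ ω, Y ω ≤ 1) {Φ : ℝ → ℝ} {α : ℝ} (hα : 0 < α) (hΦ : IsRegularlyVarying Φ α)
    (hYΦ : Tendsto (fun s => Φ s * P.real {ω | Y ω ≤ 1 / s}) atTop (𝓝 1)) :
    Tendsto (fun n : ℕ => Φ n * ∫ ω, (1 - Y ω) ^ n ∂P) atTop (𝓝 (Real.Gamma (α + 1))) := by
  have hmono : Monotone fun y => P.real {ω | Y ω ≤ y} := fun a b hab =>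
    measureReal_mono fun ω hω => le_trans hω hab
  set K : ℝ → ℝ := fun y => P.real {ω | Y ω ≤ y} with hK
  have hKneg : ∀ y ≤ 0, K y = 0 := by
    intro y hy
    have : {ω | Y ω ≤ y} = ∅ := by
      ext ω
      simpa using hy.trans_lt (hY0 ω)
    simp [hK, this]
  set g : ℕ → ℝ → ℝ := fun n z => Φ n * if z < n then K (z / n) * (1 - z / n) ^ (n - 1) else 0
    with hg
  have hcongr : (fun n : ℕ => ∫ z, g n z) =ᶠ[atTop] fun n : ℕ => Φ n * ∫ ω, (1 - Y ω) ^ n ∂P := by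
    filter_upwards [eventually_ge_atTop 1] with n hn
    rw [integral_one_sub_pow hY hY1 hn, ← integral_const_mul]
  refine Tendsto.congr' hcongr ?_
  rw [Real.Gamma_eq_integral (by linarith), ← integral_indicator measurableSet_Ioi]
  obtain ⟨u₀, hu₀, hpot⟩ := hΦ.potter one_pos
  obtain ⟨s₀, hs₀⟩ := eventually_atTop.1 (hYΦ.eventually_lt_const (show (1 : ℝ) < 2 by norm_num))
  set s₁ := max u₀ (max s₀ 1) with hs₁
  have hus : u₀ ≤ s₁ := le_max_left _ _
  have hs₁0 : 0 < s₁ := hu₀.trans_le hus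
  have hss : s₀ ≤ s₁ := (le_max_left _ _).trans (le_max_right _ _)
  have hΦs₁ := (hpot s₁ s₁ hus le_rfl).1
  -- Covers three regimes: 2 for z ≤ 1; 4·z^(α+1) by Potter's bound when n/z ≥ s₁; and
  -- 2·Φ(s₁)·z^(α+1) when n/z < s₁, where K ≤ 1 is used.
  set C := 4 + 2 * Φ s₁ with hC
  have hbound : ∀ᶠ n : ℕ in atTop, ∀ᵐ z : ℝ, ‖g n z‖ ≤
      (Ioi (0 : ℝ)).indicator
        (fun z => C * (z ^ (0 : ℝ) * Real.exp (-(1 / 2) * z ^ (1 : ℝ)) +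
          z ^ (α + 1) * Real.exp (-(1 / 2) * z ^ (1 : ℝ)))) z := by
    filter_upwards [eventually_ge_atTop 2, tendsto_natCast_atTop_atTop.eventually_ge_atTop s₁]
      with n hn2 hns
    refine Eventually.of_forall fun z => ?_
    have hn2' : (2 : ℝ) ≤ n := by exact_mod_cast hn2
    have hn0 : (0 : ℝ) < n := by linarith
    have hΦn := (hpot n n (hus.trans hns) le_rfl).1
    rcases le_or_gt z 0 with hz | hz
    · rw [indicator_of_notMem (by simpa using hz)]
      have : K (z / n) = 0 := hKneg _ (div_nonpos_of_nonpos_of_nonneg hz hn0.le)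
      simp [hg, this]
    rw [indicator_of_mem (by simpa using hz), Real.rpow_zero, Real.rpow_one, ← add_mul, ← mul_assoc]
    have hzp := Real.rpow_pos_of_pos hz (α + 1)
    by_cases hzn : z < n
    swap
    · simp only [hg, if_neg hzn, mul_zero, norm_zero]
      positivity
    have hzn1 : z / n < 1 := (div_lt_one hn0).2 hzn
    -- The rate 1/2 comes from (n - 1)/n ≥ 1/2 for n ≥ 2.
    have hexp : (1 - z / n) ^ (n - 1) ≤ Real.exp (-(1 / 2) * z) := by
      calc (1 - z / n) ^ (n - 1) ≤ Real.exp (-(z / n)) ^ (n - 1) :=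
            pow_le_pow_left₀ (by linarith) (Real.one_sub_le_exp_neg _) _
        _ = Real.exp (((n - 1 : ℕ) : ℝ) * -(z / n)) := (Real.exp_nat_mul _ _).symm
        _ ≤ _ := by
            rw [Real.exp_le_exp, Nat.cast_sub (by lia), Nat.cast_one, mul_neg, neg_mul,
              neg_le_neg_iff, mul_div_assoc', le_div_iff₀ hn0]
            nlinarith
    have hKn : Φ n * K (z / n) ≤ C * (1 + z ^ (α + 1)) := by
      rcases le_or_gt z 1 with hz1 | hz1
      · have h1 := hs₀ n (hss.trans hns)
        have h2 : K (z / n) ≤ K (1 / n) := hmono (by gcongr)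
        have h3 := mul_le_mul_of_nonneg_left h2 hΦn.le
        have : 0 < Φ s₁ * z ^ (α + 1) := by positivity
        simp only [hC]
        nlinarith
      · have hs : z / n = 1 / (n / z) := by rw [one_div_div]
        rcases le_or_gt s₁ (n / z) with h1 | h1
        · have h2 := hs₀ _ (hss.trans h1)
          have h3 := hpot (n / z) n (hus.trans h1) (by rw [div_le_iff₀ hz]; nlinarith)
          rw [div_div_cancel₀ hn0.ne'] at h3
          have hK0 : 0 ≤ K (z / n) := measureReal_nonneg
          rw [← hs] at h2
          have h4 : Φ n * K (z / n) ≤ 2 * z ^ (α + 1) * (Φ (n / z) * K (z / n)) := by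
            rw [← mul_assoc]; exact mul_le_mul_of_nonneg_right h3.2.2.1 hK0
          have : 0 < Φ s₁ * z ^ (α + 1) := by positivity
          simp only [hC]
          nlinarith
        · have h2 := (hpot s₁ n hus hns).2.2.1
          have h3 : K (z / n) ≤ 1 := measureReal_le_one
          have h4 : (n / s₁) ^ (α + 1) ≤ z ^ (α + 1) := by
            refine Real.rpow_le_rpow (by positivity) ?_ (by linarith)
            rw [div_lt_iff₀ hz] at h1
            rw [div_le_iff₀ hs₁0]; linarith
          have h5 : Φ n * K (z / n) ≤ Φ n := by nlinarith
          have h6 : 2 * (n / s₁) ^ (α + 1) * Φ s₁ ≤ 2 * z ^ (α + 1) * Φ s₁ := by gcongr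
          simp only [hC]
          nlinarith
    simp only [hg, if_pos hzn]
    have hq : 0 ≤ (1 - z / n) ^ (n - 1) := pow_nonneg (by linarith) _
    have hKz : 0 ≤ K (z / n) := measureReal_nonneg
    rw [Real.norm_of_nonneg (by positivity), ← mul_assoc]
    exact mul_le_mul hKn hexp hq (by positivity)
  refine tendsto_integral_filter_of_dominated_convergence _ ?_ hbound ?_ ?_
  · refine Eventually.of_forall fun n => ?_
    refine Measurable.aestronglyMeasurable ?_
    refine measurable_const.mul (Measurable.ite measurableSet_Iio ?_ measurable_const)
    exact (hmono.measurable.comp (measurable_id.div_const _)).mul (by fun_prop)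
  · rw [integrable_indicator_iff measurableSet_Ioi]
    exact ((integrableOn_rpow_mul_exp_neg_mul_rpow (by norm_num) one_pos (by norm_num)).add
      (integrableOn_rpow_mul_exp_neg_mul_rpow (by linarith) one_pos (by norm_num))).const_mul C
  · refine Eventually.of_forall fun z => ?_
    rcases le_or_gt z 0 with hz | hz
    · rw [indicator_of_notMem (by simpa using hz)]
      refine tendsto_const_nhds.congr fun n => ?_
      have : K (z / n) = 0 := hKneg _ (div_nonpos_of_nonpos_of_nonneg hz (by positivity))
      simp [hg, this]
    rw [indicator_of_mem (by simpa using hz), add_sub_cancel_right]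
    have hnz : Tendsto (fun n : ℕ => (n : ℝ) / z) atTop atTop :=
      tendsto_natCast_atTop_atTop.atTop_div_const hz
    have h1 := hYΦ.comp hnz
    have h2 : Tendsto (fun n : ℕ => Φ n / Φ (n / z)) atTop (𝓝 (z ^ α)) := by
      refine ((hΦ.tendsto_ratio z hz).comp hnz).congr fun n => ?_
      simp only [Function.comp]
      rw [mul_div_cancel₀ _ hz.ne']
    have h3 : Tendsto (fun n : ℕ => (1 - z / n) ^ (n - 1)) atTop (𝓝 (Real.exp (-z))) := by
      have h4 := Real.tendsto_one_add_div_pow_exp (-z)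
      have h5 : Tendsto (fun n : ℕ => 1 + -z / (n : ℝ)) atTop (𝓝 1) := by
        simpa using (tendsto_const_div_atTop_nhds_zero_nat (-z)).const_add 1
      have h6 := h4.div h5 one_ne_zero
      rw [div_one] at h6
      refine h6.congr' ?_
      filter_upwards [tendsto_natCast_atTop_atTop.eventually_gt_atTop z,
        eventually_ge_atTop 1] with n hn hn1
      have hn0 : (0 : ℝ) < n := hz.trans hn
      have h7 : 0 < 1 - z / n := by rw [sub_pos, div_lt_one hn0]; exact hn
      obtain ⟨m, rfl⟩ := Nat.exists_eq_add_of_le' hn1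
      simp only [Pi.div_apply]
      rw [neg_div, ← sub_eq_add_neg, Nat.add_sub_cancel, pow_succ, mul_div_cancel_right₀ _ h7.ne']
    have h8 := (h3.mul h2).mul h1
    rw [mul_one] at h8
    refine h8.congr' ?_
    filter_upwards [tendsto_natCast_atTop_atTop.eventually_gt_atTop z,
      hnz.eventually hΦ.eventually_pos] with n hn hp
    simp only [Function.comp, hg, if_pos hn, one_div_div, hK]
    field_simp

end Tauberian

/-! ### Moment and deviation bounds for i.i.d. sums; the probability of n failures -/

section SumsOfIID

variable {Ω : Type*} [MeasurableSpace Ω] {P : Measure Ω} [IsProbabilityMeasure P]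

theorem integrable_rpow_of_le {X : Ω → ℝ} (hX : Measurable X) (hX0 : ∀ᵐ ω ∂P, 0 ≤ X ω) {p q : ℝ}
    (hp : 0 ≤ p) (hpq : p ≤ q) (hq : Integrable (fun ω => X ω ^ q) P) :
    Integrable (fun ω => X ω ^ p) P := by
  refine ((integrable_const (1 : ℝ)).add hq).mono' (hX.pow_const p).aestronglyMeasurable ?_
  filter_upwards [hX0] with ω hω
  rw [Real.norm_of_nonneg (by positivity)]
  have h1 : 0 ≤ X ω ^ q := by positivity
  rcases le_total (X ω) 1 with h | h
  · have := Real.rpow_le_one hω h hp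
    simp only [Pi.add_apply]; linarith
  · have := Real.rpow_le_rpow_of_exponent_le h hpq
    simp only [Pi.add_apply]; linarith

/-- **Markov's inequality** for fractional moments. -/
theorem exists_prob_gt_le_rpow {X : Ω → ℝ} (hX0 : ∀ᵐ ω ∂P, 0 ≤ X ω)
    {p : ℝ} (hp : 0 < p) (hq : Integrable (fun ω => X ω ^ p) P) {δ : ℝ} (hδ : 0 < δ) :
    ∃ C, 0 ≤ C ∧ ∀ t, 0 < t → P.real {ω | δ * t < X ω} ≤ C * t ^ (-p) := by
  have h0 : 0 ≤ᵐ[P] fun ω => X ω ^ p := hX0.mono fun ω h => Real.rpow_nonneg h p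
  refine ⟨(∫ ω, X ω ^ p ∂P) * δ ^ (-p), mul_nonneg (integral_nonneg_of_ae h0) (by positivity),
    fun t ht => ?_⟩
  have hm := mul_meas_ge_le_integral_of_nonneg h0 hq ((δ * t) ^ p)
  have hsub : P.real {ω | δ * t < X ω} ≤ P.real {ω | (δ * t) ^ p ≤ X ω ^ p} :=
    measureReal_mono fun ω hω =>
      Real.rpow_le_rpow (by positivity) (le_of_lt (show δ * t < X ω from hω)) hp.le
  rw [mul_assoc, ← Real.mul_rpow hδ.le ht.le, Real.rpow_neg (by positivity), ← div_eq_mul_inv,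
    le_div_iff₀' (by positivity)]
  exact (mul_le_mul_of_nonneg_left hsub (by positivity)).trans hm

/-- **Chernoff bound** for sums of functions of i.i.d. random variables. -/
theorem prob_le_sum_le_exp {X : ℕ → Ω → ℝ} (hX : ∀ i, Measurable (X i)) (hind : iIndepFun X P)
    (hid : ∀ i, IdentDistrib (X i) (X 0) P P) {g : ℝ → ℝ} (hg : Measurable g) {s K : ℝ}
    (hs : 0 ≤ s) (hint : ∀ i, Integrable (fun ω => Real.exp (s * g (X i ω))) P)
    (hK : ∫ ω, Real.exp (s * g (X 0 ω)) ∂P ≤ Real.exp K) (n : ℕ) (a : ℝ) :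
    P.real {ω | a ≤ ∑ i ∈ Finset.range n, g (X i ω)} ≤ Real.exp (n * K - s * a) := by
  have hmeas : ∀ i, Measurable (g ∘ X i) := fun i => hg.comp (hX i)
  have hindg : iIndepFun (fun i => g ∘ X i) P := hind.comp _ fun _ => hg
  have hch := measure_ge_le_exp_mul_mgf (X := ∑ i ∈ Finset.range n, g ∘ X i) (μ := P) a hs
    (hindg.integrable_exp_mul_sum hmeas fun i _ => hint i)
  rw [hindg.mgf_sum hmeas] at hch
  have hprod : ∏ i ∈ Finset.range n, mgf (g ∘ X i) P s ≤ Real.exp K ^ n := by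
    calc _ ≤ ∏ i ∈ Finset.range n, Real.exp K := by
          refine Finset.prod_le_prod (fun i _ => mgf_nonneg) fun i _ => ?_
          rw [mgf_congr_of_identDistrib _ _ ((hid i).comp hg)]
          exact hK
      _ = _ := by simp
  have heq : {ω | a ≤ ∑ i ∈ Finset.range n, g (X i ω)} =
      {ω | a ≤ (∑ i ∈ Finset.range n, g ∘ X i) ω} := by
    ext ω
    simp [Finset.sum_apply]
  rw [heq]
  refine hch.trans ((mul_le_mul_of_nonneg_left hprod (Real.exp_pos _).le).trans (le_of_eq ?_))
  rw [← Real.exp_nat_mul, ← Real.exp_add]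
  ring_nf

/-- Exponential lower tail bound for sums of non-negative i.i.d. random variables. -/
theorem exists_prob_sum_le_exp {X : ℕ → Ω → ℝ} (hX : ∀ i, Measurable (X i))
    (hX0 : ∀ i, ∀ᵐ ω ∂P, 0 ≤ X i ω) (hind : iIndepFun X P)
    (hid : ∀ i, IdentDistrib (X i) (X 0) P P) (hint : Integrable (X 0) P) {ε : ℝ} (hε : 0 < ε) :
    ∃ ρ, 0 < ρ ∧ ∀ n : ℕ,
      P.real {ω | ∑ i ∈ Finset.range n, X i ω ≤ n * (∫ ω, X 0 ω ∂P - ε)} ≤ Real.exp (-ρ * n) := by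
  set m := ∫ ω, X 0 ω ∂P with hm
  -- The Laplace transform has right derivative -m at 0, by domination by `X 0`; no higher moment is
  -- needed.
  have hlim : Tendsto (fun l : ℝ => ∫ ω, (1 - Real.exp (-(l * X 0 ω))) / l ∂P) (𝓝[>] 0) (𝓝 m) := by
    refine tendsto_integral_filter_of_dominated_convergence (fun ω => X 0 ω) ?_ ?_ hint ?_
    · have := hX 0
      exact Eventually.of_forall fun l => by fun_prop
    · refine eventually_mem_nhdsWithin.mono fun l hl => ?_
      have hl' : 0 < l := hl
      filter_upwards [hX0 0] with ω hω
      have h1 := Real.one_sub_le_exp_neg (l * X 0 ω)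
      have h2 : Real.exp (-(l * X 0 ω)) ≤ 1 := Real.exp_le_one_iff.2 (by
        have := mul_nonneg hl'.le hω
        linarith)
      rw [Real.norm_of_nonneg (div_nonneg (by linarith) hl'.le), div_le_iff₀ hl']
      linarith
    · refine Eventually.of_forall fun ω => ?_
      have hd : HasDerivAt (fun l : ℝ => 1 - Real.exp (-(l * X 0 ω))) (X 0 ω) 0 := by
        have := ((((hasDerivAt_id (0 : ℝ)).mul_const (X 0 ω)).neg).exp).const_sub 1
        simpa using this
      have := hd.tendsto_slope_zero_right
      refine this.congr fun l => ?_
      simp [div_eq_inv_mul]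
  obtain ⟨l, hl1, hl0⟩ :=
    ((hlim.eventually_const_lt (show m - ε / 2 < m by linarith)).and self_mem_nhdsWithin).exists
  have hl : 0 < l := hl0
  have hintexp : ∀ i, Integrable (fun ω => Real.exp (l * -X i ω)) P := by
    intro i
    have := hX i
    refine (integrable_const (1 : ℝ)).mono' (by fun_prop) ?_
    filter_upwards [hX0 i] with ω hω
    rw [Real.norm_of_nonneg (Real.exp_pos _).le, Real.exp_le_one_iff]
    have := mul_nonneg hl.le hω
    linarith
  have hK : ∫ ω, Real.exp (l * -X 0 ω) ∂P ≤ Real.exp (-(l * (m - ε / 2))) := by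
    rw [integral_div, lt_div_iff₀ hl] at hl1
    simp only [← mul_neg] at hl1
    rw [integral_sub (integrable_const _) (hintexp 0)] at hl1
    simp only [integral_const, probReal_univ, smul_eq_mul, mul_one] at hl1
    have := Real.one_sub_le_exp_neg (l * (m - ε / 2))
    linarith
  refine ⟨l * ε / 2, by positivity, fun n => ?_⟩
  have := prob_le_sum_le_exp hX hind hid (g := fun x => -x) measurable_neg hl.le hintexp hK n
    (-(n * (m - ε)))
  simp only [Finset.sum_neg_distrib, neg_le_neg_iff] at this
  refine this.trans (le_of_eq ?_)
  ring_nf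

/-- From e^y(1 - y) ≤ 1. The Taylor remainder is weakened to order 1 + θ so that a moment of that
order controls its expectation. -/
theorem exp_le_one_add_add_rpow {y θ : ℝ} (hy : 0 ≤ y) (hθ0 : 0 < θ) (hθ : θ ≤ 1) :
    Real.exp y ≤ 1 + y + y ^ (1 + θ) * Real.exp y := by
  have h1 := Real.one_sub_le_exp_neg y
  have h2 : Real.exp y * (1 - y) ≤ 1 := by
    calc _ ≤ Real.exp y * Real.exp (-y) := mul_le_mul_of_nonneg_left h1 (Real.exp_pos _).le
      _ = 1 := by rw [← Real.exp_add]; simp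
  have h0 := Real.exp_pos y
  rcases le_total y 1 with h | h
  · have h3 : y ^ (2 : ℝ) ≤ y ^ (1 + θ) := by
      rcases hy.eq_or_lt with rfl | hy'
      · rw [Real.zero_rpow (by norm_num), Real.zero_rpow (by linarith)]
      · exact Real.rpow_le_rpow_of_exponent_ge hy' h (by linarith)
    have h4 : y ^ (2 : ℝ) = y ^ 2 := Real.rpow_two y
    have h5 := mul_le_mul_of_nonneg_right h3 h0.le
    rw [h4] at h5
    nlinarith
  · have h3 : y ^ (1 : ℝ) ≤ y ^ (1 + θ) := Real.rpow_le_rpow_of_exponent_le h (by linarith)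
    rw [Real.rpow_one] at h3
    have h5 := mul_le_mul_of_nonneg_right h3 h0.le
    linarith

/-- The truncation level survives only in the exponential of the remainder; elsewhere the truncated
variable is bounded by `X`. -/
theorem integral_exp_mul_min_le {X : Ω → ℝ} (hX0 : ∀ᵐ ω ∂P, 0 ≤ X ω)
    (hint : Integrable X P) {θ : ℝ} (hθ0 : 0 < θ) (hθ : θ ≤ 1)
    (hmom : Integrable (fun ω => X ω ^ (1 + θ)) P) {s b : ℝ} (hs : 0 ≤ s) (hb : 0 ≤ b) :
    ∫ ω, Real.exp (s * min (X ω) b) ∂P ≤ Real.exp (s * (∫ ω, X ω ∂P) +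
      s ^ (1 + θ) * (∫ ω, X ω ^ (1 + θ) ∂P) * Real.exp (s * b)) := by
  have hle : ∫ ω, Real.exp (s * min (X ω) b) ∂P ≤
      ∫ ω, (1 + s * X ω + s ^ (1 + θ) * X ω ^ (1 + θ) * Real.exp (s * b)) ∂P := by
    refine integral_mono_of_nonneg (Eventually.of_forall fun ω => (Real.exp_pos _).le)
      (((integrable_const _).add (hint.const_mul s)).add ((hmom.const_mul _).mul_const _)) ?_
    filter_upwards [hX0] with ω hω
    have h0 : 0 ≤ min (X ω) b := le_min hω hb
    have h1 := exp_le_one_add_add_rpow (mul_nonneg hs h0) hθ0 hθ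
    have h2 : s * min (X ω) b ≤ s * X ω := by gcongr; exact min_le_left _ _
    have h3 : s * min (X ω) b ≤ s * b := by gcongr; exact min_le_right _ _
    have h4 : (s * min (X ω) b) ^ (1 + θ) ≤ s ^ (1 + θ) * X ω ^ (1 + θ) := by
      rw [← Real.mul_rpow hs hω]
      exact Real.rpow_le_rpow (mul_nonneg hs h0) h2 (by linarith)
    have h5 : (s * min (X ω) b) ^ (1 + θ) * Real.exp (s * min (X ω) b) ≤
        s ^ (1 + θ) * X ω ^ (1 + θ) * Real.exp (s * b) := by
      gcongr
    linarith
  refine hle.trans ?_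
  have hi : Integrable (fun ω => 1 + s * X ω) P := (integrable_const _).add (hint.const_mul s)
  rw [integral_add hi ((hmom.const_mul _).mul_const _),
    integral_add (integrable_const _) (hint.const_mul s), integral_mul_const, integral_const_mul,
    integral_const_mul]
  simp only [integral_const, probReal_univ, smul_eq_mul, mul_one]
  refine le_trans (le_of_eq ?_) (Real.add_one_le_exp _)
  ring

/-- Large deviations of truncated sums: truncating at a small multiple of `t` makes the probability
that a sum of at most `κ t` terms exceeds its mean by `ε t` smaller than any given power. -/
theorem exists_prob_sum_min_le_rpow {X : ℕ → Ω → ℝ} (hX : ∀ i, Measurable (X i))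
    (hX0 : ∀ i, ∀ᵐ ω ∂P, 0 ≤ X i ω) (hind : iIndepFun X P)
    (hid : ∀ i, IdentDistrib (X i) (X 0) P P) {θ : ℝ} (hθ0 : 0 < θ) (hθ : θ ≤ 1)
    (hint : Integrable (X 0) P) (hmom : Integrable (fun ω => X 0 ω ^ (1 + θ)) P)
    {κ ε β : ℝ} (hκ : 0 < κ) (hε : 0 < ε) (hβ : 0 < β) :
    ∃ δ₀, 0 < δ₀ ∧ ∀ δ, 0 < δ → δ ≤ δ₀ → ∀ᶠ t : ℝ in atTop,
      P.real {ω | κ * t * (∫ ω, X 0 ω ∂P) + ε * t ≤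
        ∑ i ∈ Finset.range ⌊κ * t⌋₊, min (X i ω) (δ * t)} ≤ Real.exp 1 * t ^ (-β) := by
  set m := ∫ ω, X 0 ω ∂P
  set M := ∫ ω, X 0 ω ^ (1 + θ) ∂P
  have hm : 0 ≤ m := integral_nonneg_of_ae (hX0 0)
  have hM : 0 ≤ M := integral_nonneg_of_ae ((hX0 0).mono fun ω h => Real.rpow_nonneg h _)
  -- With s = c·log t / t, the excess εt contributes e^(-sεt) = t^(-β). Taking cδ ≤ θ/2 makes the
  -- remainder O((log t)^(1+θ)·t^(-θ/2)), eventually at most 1; hence the factor e.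
  set c := β / ε with hc
  have hc0 : 0 < c := by positivity
  refine ⟨θ / 2 / c, by positivity, fun δ hδ hδ0 => ?_⟩
  have hcδ : c * δ ≤ θ / 2 := by rw [le_div_iff₀ hc0] at hδ0; linarith
  have hlog : Tendsto (fun t : ℝ => κ * M * c ^ (1 + θ) *
      (Real.log t ^ (1 + θ) / t ^ (θ / 2))) atTop (𝓝 0) := by
    have := (isLittleO_log_rpow_rpow_atTop (1 + θ) (show 0 < θ / 2 by positivity)).tendsto_div_nhds_zero
    simpa using this.const_mul (κ * M * c ^ (1 + θ))
  filter_upwards [hlog.eventually_le_const one_pos, eventually_ge_atTop (1 : ℝ)] with t ht ht1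
  have ht0 : 0 < t := by linarith
  have hlt : 0 ≤ Real.log t := Real.log_nonneg ht1
  set s := c * Real.log t / t with hs
  have hs0 : 0 ≤ s := by positivity
  have hst : s * t = c * Real.log t := by rw [hs]; field_simp
  have hexp : Real.exp (s * (δ * t)) = t ^ (c * δ) := by
    rw [Real.rpow_def_of_pos ht0]
    congr 1
    calc s * (δ * t) = δ * (s * t) := by ring
      _ = _ := by rw [hst]; ring
  have hch := prob_le_sum_le_exp hX hind hid (g := fun x => min x (δ * t))
    (measurable_id.min measurable_const) hs0 (fun i => by
      have := hX i
      refine (integrable_const (Real.exp (s * (δ * t)))).mono' (by fun_prop)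
        (Eventually.of_forall fun ω => ?_)
      rw [Real.norm_of_nonneg (Real.exp_pos _).le, Real.exp_le_exp]
      gcongr
      exact min_le_right _ _)
    (integral_exp_mul_min_le (hX0 0) hint hθ0 hθ hmom hs0 (by positivity : 0 ≤ δ * t))
    ⌊κ * t⌋₊ (κ * t * m + ε * t)
  refine hch.trans ?_
  rw [Real.rpow_def_of_pos ht0, ← Real.exp_add, Real.exp_le_exp, hexp]
  have hn : (⌊κ * t⌋₊ : ℝ) ≤ κ * t := Nat.floor_le (by positivity)
  have h1 : (⌊κ * t⌋₊ : ℝ) * (s * m + s ^ (1 + θ) * M * t ^ (c * δ)) ≤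
      κ * t * (s * m + s ^ (1 + θ) * M * t ^ (c * δ)) := by gcongr
  have h2 : κ * t * (s ^ (1 + θ) * M * t ^ (c * δ)) ≤ 1 := by
    refine le_trans ?_ ht
    have e1 : s ^ (1 + θ) = c ^ (1 + θ) * Real.log t ^ (1 + θ) / t ^ (1 + θ) := by
      rw [hs, Real.div_rpow (by positivity) ht0.le, Real.mul_rpow hc0.le hlt]
    have e2 : t * (t ^ (c * δ) / t ^ (1 + θ)) ≤ 1 / t ^ (θ / 2) := by
      rw [← Real.rpow_sub ht0, ← Real.rpow_one_add' ht0.le, one_div, ← Real.rpow_neg ht0.le]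
      · exact Real.rpow_le_rpow_of_exponent_le ht1 (by linarith)
      · have : 0 < c * δ := by positivity
        intro h
        nlinarith
    calc κ * t * (s ^ (1 + θ) * M * t ^ (c * δ))
        = κ * M * c ^ (1 + θ) * Real.log t ^ (1 + θ) * (t * (t ^ (c * δ) / t ^ (1 + θ))) := by
          rw [e1]; ring
      _ ≤ κ * M * c ^ (1 + θ) * Real.log t ^ (1 + θ) * (1 / t ^ (θ / 2)) := by gcongr
      _ = _ := by ring
  have h3 : s * (κ * t * m + ε * t) = κ * t * (s * m) + β * Real.log t := by
    calc _ = κ * t * (s * m) + ε * (s * t) := by ring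
      _ = _ := by rw [hst, hc]; field_simp
  linarith

/-- The probability that the first `n` attempts fail. -/
theorem prob_forall_lt_eq_integral {A : ℕ → Ω → ℝ} {L : Ω → ℝ} (hA : ∀ i, Measurable (A i))
    (hL : Measurable L) (hind : iIndepFun A P) (hid : ∀ i, IdentDistrib (A i) (A 0) P P)
    (hLA : IndepFun L (fun ω i => A i ω) P) (n : ℕ) :
    P.real {ω | ∀ i < n, A i ω < L ω} = ∫ ω, (1 - P.real {ω' | L ω ≤ A 0 ω'}) ^ n ∂P := by
  have hA' : Measurable fun ω i => A i ω := measurable_pi_lambda _ hA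
  set S : Set (ℝ × (ℕ → ℝ)) := {x | ∀ i < n, x.2 i < x.1} with hS
  have hSm : MeasurableSet S := by
    have : S = ⋂ i, ⋂ (_ : i < n), {x | x.2 i < x.1} := by ext; simp [hS]
    rw [this]
    refine MeasurableSet.iInter fun i => MeasurableSet.iInter fun _ => ?_
    exact measurableSet_lt ((measurable_pi_apply i).comp measurable_snd) measurable_fst
  have hsec : ∀ l : ℝ, P.map (fun ω i => A i ω) (Prod.mk l ⁻¹' S) =
      ENNReal.ofReal ((1 - P.real {ω' | l ≤ A 0 ω'}) ^ n) := by
    intro l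
    rw [Measure.map_apply hA' (measurable_prodMk_left hSm)]
    have e : (fun ω i => A i ω) ⁻¹' (Prod.mk l ⁻¹' S) = ⋂ i ∈ Finset.range n, A i ⁻¹' Iio l := by
      ext ω; simp [hS]
    rw [e, hind.measure_inter_preimage_eq_mul _ fun _ _ => measurableSet_Iio]
    have h1 : ∀ i ∈ Finset.range n, P (A i ⁻¹' Iio l) = P (A 0 ⁻¹' Iio l) := fun i _ =>
      (hid i).measure_mem_eq measurableSet_Iio
    have h2 : P (A 0 ⁻¹' Iio l) = ENNReal.ofReal (1 - P.real {ω' | l ≤ A 0 ω'}) := by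
      rw [← probReal_compl_eq_one_sub (measurableSet_le measurable_const (hA 0)),
        ofReal_measureReal]
      congr 1
      ext ω; simp
    rw [Finset.prod_congr rfl h1, Finset.prod_const, Finset.card_range, h2,
      ENNReal.ofReal_pow (sub_nonneg.2 measureReal_le_one)]
  have hmono : Antitone fun l => P.real {ω' | l ≤ A 0 ω'} := fun a b hab =>
    measureReal_mono fun ω hω => le_trans hab hω
  have hmeas : Measurable fun l => (1 - P.real {ω' | l ≤ A 0 ω'}) ^ n :=
    (hmono.measurable.const_sub 1).pow_const n
  have hP : P {ω | ∀ i < n, A i ω < L ω} =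
      ∫⁻ ω, ENNReal.ofReal ((1 - P.real {ω' | L ω ≤ A 0 ω'}) ^ n) ∂P := by
    have e : {ω | ∀ i < n, A i ω < L ω} = (fun ω => (L ω, fun i => A i ω)) ⁻¹' S := rfl
    rw [e, ← Measure.map_apply (hL.prodMk hA') hSm,
      hLA.map_prod_eq_prod_map_map hL.aemeasurable hA'.aemeasurable, Measure.prod_apply hSm]
    simp only [hsec]
    rw [lintegral_map hmeas.ennreal_ofReal hL]
  rw [integral_eq_lintegral_of_nonneg_ae
    (Eventually.of_forall fun ω => pow_nonneg (sub_nonneg.2 measureReal_le_one) _)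
    (hmeas.comp hL).aestronglyMeasurable, ← hP]
  rfl

end SumsOfIID


/-! ### Pathwise comparison of the total time with sums -/

section Pathwise

variable {Ω : Type*} {A U : ℕ → Ω → ℝ} {L : Ω → ℝ} {ω : Ω}

theorem totalTime_eq_top (h : ∀ i, A i ω < L ω) : totalTime A U L ω = ⊤ := by
  have : numTransmissions A L ω = ⊤ := by
    refine sInf_eq_top.2 ?_
    rintro _ ⟨i, -, hi⟩
    exact absurd (h i) (not_lt.2 hi)
  rw [totalTime, if_pos this]

theorem totalTime_eq_of_first {k : ℕ} (h : ∀ i < k, A i ω < L ω) (hk : L ω ≤ A k ω) :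
    totalTime A U L ω = ((∑ i ∈ Finset.range k, (A i ω + U i ω) + L ω : ℝ) : EReal) := by
  -- Success at index k, counted from 0, is transmission k + 1, so exactly the indices below k enter
  -- the sum.
  have hN : numTransmissions A L ω = ((k + 1 : ℕ) : ℕ∞) := by
    refine le_antisymm (sInf_le ⟨k, by norm_cast, hk⟩) (le_sInf ?_)
    rintro _ ⟨i, rfl, hi⟩
    have : k ≤ i := not_lt.1 fun hik => absurd (h i hik) (not_lt.2 hi)
    exact_mod_cast Nat.succ_le_succ this
  rw [totalTime, if_neg (by rw [hN]; exact ENat.natCast_ne_top _), hN, ENat.toNat_natCast,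
    Nat.add_sub_cancel]

theorem forall_lt_or_exists_first (n : ℕ) :
    (∀ i < n, A i ω < L ω) ∨ ∃ k < n, (∀ i < k, A i ω < L ω) ∧ L ω ≤ A k ω := by
  classical
  by_cases h : ∃ k, L ω ≤ A k ω
  · have h1 := Nat.find_spec h
    have h2 : ∀ i < Nat.find h, A i ω < L ω := fun i hi => not_le.1 (Nat.find_min h hi)
    rcases lt_or_ge (Nat.find h) n with h3 | h3
    · exact Or.inr ⟨_, h3, h2, h1⟩
    · exact Or.inl fun i hi => h2 i (hi.trans_le h3)
  · push Not at h
    exact Or.inl fun i _ => h i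

/-- The ways in which the total time can exceed `t`. -/
theorem lt_totalTime_cases (hA : ∀ i, 0 ≤ A i ω) (hU : ∀ i, 0 ≤ U i ω) {t δ a u : ℝ} (n : ℕ)
    (hδt : 0 ≤ δ * t) (hau : a + u ≤ (1 - δ) * t) (ht : (t : EReal) < totalTime A U L ω) :
    (∀ i < n, A i ω < L ω) ∨ δ * t < L ω ∨
      (∃ i < n, (∀ j < i, A j ω < L ω) ∧ δ * t < U i ω) ∨
      a ≤ ∑ i ∈ Finset.range n, min (A i ω) (δ * t) ∨
      u ≤ ∑ i ∈ Finset.range n, min (U i ω) (δ * t) := by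
  rcases forall_lt_or_exists_first (A := A) (L := L) (ω := ω) n with h | ⟨k, hkn, hk, hkL⟩
  · exact Or.inl h
  right
  rw [totalTime_eq_of_first hk hkL, EReal.coe_lt_coe_iff, Finset.sum_add_distrib] at ht
  by_contra! hcon
  obtain ⟨hL, hUi, hAs, hUs⟩ := hcon
  have hsub : Finset.range k ⊆ Finset.range n := Finset.range_mono hkn.le
  -- Failed periods satisfy A_i < L ≤ δt, so truncation leaves them unchanged.
  have h1 : ∑ i ∈ Finset.range k, A i ω ≤ ∑ i ∈ Finset.range n, min (A i ω) (δ * t) := by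
    calc _ = ∑ i ∈ Finset.range k, min (A i ω) (δ * t) := by
          refine Finset.sum_congr rfl fun i hi => (min_eq_left ?_).symm
          exact (hk i (Finset.mem_range.1 hi)).le.trans hL
      _ ≤ _ := Finset.sum_le_sum_of_subset_of_nonneg hsub fun i _ _ => le_min (hA i) hδt
  have h2 : ∑ i ∈ Finset.range k, U i ω ≤ ∑ i ∈ Finset.range n, min (U i ω) (δ * t) := by
    calc _ = ∑ i ∈ Finset.range k, min (U i ω) (δ * t) := by
          refine Finset.sum_congr rfl fun i hi => (min_eq_left ?_).symm
          exact hUi i (Finset.mem_range.1 (hsub hi)) fun j hj => hk j (hj.trans (Finset.mem_range.1 hi))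
      _ ≤ _ := Finset.sum_le_sum_of_subset_of_nonneg hsub fun i _ _ => le_min (hU i) hδt
  linarith

theorem lt_totalTime_of_lt_sum (hA : ∀ i, 0 ≤ A i ω) (hU : ∀ i, 0 ≤ U i ω) (hL : 0 ≤ L ω)
    {n : ℕ} (hn : ∀ i < n, A i ω < L ω) {t : ℝ}
    (ht : t < ∑ i ∈ Finset.range n, A i ω + ∑ i ∈ Finset.range n, U i ω) :
    (t : EReal) < totalTime A U L ω := by
  by_cases h : ∀ i, A i ω < L ω
  · rw [totalTime_eq_top h]; exact EReal.coe_lt_top t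
  push Not at h
  obtain ⟨j, hj⟩ := h
  rcases forall_lt_or_exists_first (A := A) (L := L) (ω := ω) (j + 1) with h | ⟨k, -, hk, hkL⟩
  · exact absurd (h j (Nat.lt_succ_self j)) (not_lt.2 hj)
  rw [totalTime_eq_of_first hk hkL, EReal.coe_lt_coe_iff]
  have hnk : n ≤ k := not_lt.1 fun hkn => absurd (hn k hkn) (not_lt.2 hkL)
  rw [← Finset.sum_add_distrib] at ht
  have := Finset.sum_le_sum_of_subset_of_nonneg (f := fun i => A i ω + U i ω)
    (Finset.range_mono hnk) fun i _ _ => add_nonneg (hA i) (hU i)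
  linarith

end Pathwise

/-! ### From integer to real arguments, and power bounds -/

section Asymptotics

variable {Φ : ℝ → ℝ} {α : ℝ}

/-- Discrete integral comparison: Bernoulli's inequality for the exponent 1 - γ bounds each term by
a telescoping increment. -/
theorem sum_range_rpow_neg_le {γ : ℝ} (hγ0 : 0 < γ) (hγ1 : γ < 1) (n : ℕ) :
    ∑ i ∈ Finset.range n, ((i : ℝ) + 1) ^ (-γ) ≤ (n : ℝ) ^ (1 - γ) / (1 - γ) := by
  have hp : 0 < 1 - γ := by linarith
  induction n with
  | zero => simp [Real.zero_rpow hp.ne']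
  | succ n ih =>
    rw [Finset.sum_range_succ, Nat.cast_succ]
    have hn : (0 : ℝ) < (n : ℝ) + 1 := by positivity
    have h1 := rpow_one_add_le_one_add_mul_self (s := -(1 / ((n : ℝ) + 1))) (p := 1 - γ)
      (by rw [neg_le_neg_iff, div_le_one hn]; linarith [(Nat.cast_nonneg n : (0 : ℝ) ≤ n)])
      hp.le (by linarith)
    have e1 : 1 + -(1 / ((n : ℝ) + 1)) = n / ((n : ℝ) + 1) := by field_simp; ring
    rw [e1, Real.div_rpow (by positivity) hn.le, div_le_iff₀ (by positivity)] at h1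
    have e2 : ((n : ℝ) + 1) ^ (1 - γ) = ((n : ℝ) + 1) * ((n : ℝ) + 1) ^ (-γ) := by
      rw [sub_eq_add_neg, Real.rpow_add hn, Real.rpow_one]
    rw [le_div_iff₀ hp] at ih ⊢
    have e3 : (1 + (1 - γ) * -(1 / ((n : ℝ) + 1))) * ((n : ℝ) + 1) ^ (1 - γ) =
        ((n : ℝ) + 1) ^ (1 - γ) - (1 - γ) * ((n : ℝ) + 1) ^ (-γ) := by
      rw [e2]; field_simp; ring
    rw [e3] at h1
    linarith

namespace IsRegularlyVarying

theorem tendsto_mul_comp_nat (hΦ : IsRegularlyVarying Φ α) {b : ℕ → ℝ} {c : ℝ}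
    (hb : Tendsto (fun n : ℕ => Φ n * b n) atTop (𝓝 c)) {n : ℝ → ℕ} {κ : ℝ} (hκ : 0 < κ)
    (hn : Tendsto (fun t => (n t : ℝ) / t) atTop (𝓝 κ)) :
    Tendsto (fun t => Φ t * b (n t)) atTop (𝓝 (c * κ⁻¹ ^ α)) := by
  have hninf : Tendsto (fun t => (n t : ℝ)) atTop atTop := by
    refine (hn.pos_mul_atTop hκ tendsto_id).congr' ?_
    filter_upwards [eventually_gt_atTop 0] with t ht
    exact div_mul_cancel₀ _ ht.ne'
  have hninf' : Tendsto n atTop atTop := tendsto_natCast_atTop_iff.1 hninf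
  have h1 := hΦ.tendsto_ratio_of_tendsto (s := fun t => (n t : ℝ)) (u := fun t => t)
    (inv_pos.2 hκ) hninf ((hn.inv₀ hκ.ne').congr fun t => inv_div _ _)
  refine ((hb.comp hninf').mul h1).congr' ?_
  filter_upwards [hninf.eventually hΦ.eventually_pos] with t ht
  simp only [Function.comp]
  have := ht.ne'
  field_simp

/-- Giving up a little of the exponent yields a bound valid for every n, as the union bound over all
attempts requires. -/
theorem exists_le_rpow_of_tendsto (hΦ : IsRegularlyVarying Φ α) {b : ℕ → ℝ} {c : ℝ}
    (hb : Tendsto (fun n : ℕ => Φ n * b n) atTop (𝓝 c)) {γ : ℝ} (hγ0 : 0 < γ) (hγ : γ < α) :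
    ∃ C, 0 ≤ C ∧ ∀ n : ℕ, b n ≤ C * ((n : ℝ) + 1) ^ (-γ) := by
  have h1 : Tendsto (fun t => (Φ t)⁻¹ * |t + 1| ^ γ) atTop (𝓝 0) := by
    refine hΦ.inv.tendsto_mul_of_le_rpow (β := -γ) (C := 2 ^ γ) (by linarith)
      (fun t => by positivity) ?_
    filter_upwards [eventually_ge_atTop 1] with t ht
    rw [neg_neg, ← Real.mul_rpow (by norm_num) (by linarith)]
    refine Real.rpow_le_rpow (abs_nonneg _) ?_ hγ0.le
    rw [abs_of_nonneg (by linarith)]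
    linarith
  have h2 := (h1.comp tendsto_natCast_atTop_atTop).mul hb
  have h3 : Tendsto (fun n : ℕ => ((n : ℝ) + 1) ^ γ * b n) atTop (𝓝 (0 * c)) := by
    refine h2.congr' ?_
    filter_upwards [tendsto_natCast_atTop_atTop.eventually hΦ.eventually_pos] with n hn
    simp only [Function.comp]
    rw [abs_of_nonneg (by positivity)]
    have := hn.ne'
    field_simp
  obtain ⟨C, hC⟩ := h3.bddAbove_range
  refine ⟨max C 0, le_max_right _ _, fun n => ?_⟩
  have hn : (0 : ℝ) < ((n : ℝ) + 1) ^ γ := by positivity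
  rw [Real.rpow_neg (by positivity), ← div_eq_mul_inv, le_div_iff₀' hn]
  exact (hC (mem_range_self n)).trans (le_max_left _ _)

end IsRegularlyVarying

end Asymptotics

/-! ### Positivity of the tail of `A`, and independence -/

section Probability

variable {Ω : Type*} [MeasurableSpace Ω] {P : Measure Ω} [IsProbabilityMeasure P]

/-- If the tail of `X` vanished somewhere, the convention 0⁻¹ = 0 would make the denominator
eventually the constant Φ(0), while the numerator tends to infinity. -/
theorem ccdf_pos_of_equiv {X L : Ω → ℝ} (hL : Measurable L)
    (hL_supp : ∀ x, 0 ≤ x → 0 < ccdf P L x) {Φ : ℝ → ℝ}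
    (h : Tendsto (fun x => (ccdf P L x)⁻¹ / Φ ((ccdf P X x)⁻¹)) atTop (𝓝 1)) (x : ℝ) :
    0 < ccdf P X x := by
  refine measureReal_nonneg.lt_of_ne' fun hx => ?_
  have hzero : ∀ y, x ≤ y → ccdf P X y = 0 := fun y hy =>
    le_antisymm ((ccdf_antitone X hy).trans hx.le) measureReal_nonneg
  have h1 : Tendsto (fun y => (ccdf P L y)⁻¹ / Φ 0) atTop (𝓝 1) := by
    refine h.congr' ?_
    filter_upwards [eventually_ge_atTop x] with y hy
    rw [hzero y hy, inv_zero]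
  have h2 : Tendsto (fun y => (ccdf P L y)⁻¹) atTop atTop :=
    tendsto_inv_nhdsGT_zero.comp (tendsto_nhdsWithin_iff.2 ⟨tendsto_ccdf_atTop hL,
      (eventually_ge_atTop 0).mono hL_supp⟩)
  have hΦ0 : Φ 0 ≠ 0 := by
    intro h0
    simp only [h0, div_zero] at h1
    exact zero_ne_one (tendsto_nhds_unique tendsto_const_nhds h1)
  refine not_tendsto_nhds_of_tendsto_atTop h2 (1 * Φ 0) ((h1.mul_const (Φ 0)).congr fun y => ?_)
  exact div_mul_cancel₀ _ hΦ0

theorem prob_forall_lt_and_gt {A U : ℕ → Ω → ℝ} {L : Ω → ℝ} (hA : ∀ i, Measurable (A i))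
    (hU : ∀ i, Measurable (U i)) (hL : Measurable L)
    (hAU : IndepFun (fun ω i => A i ω) (fun ω i => U i ω) P)
    (hLAU : IndepFun L (fun ω => ((fun i => A i ω), (fun i => U i ω))) P) (n : ℕ) (u : ℝ) :
    P.real {ω | (∀ i < n, A i ω < L ω) ∧ u < U n ω} =
      P.real {ω | ∀ i < n, A i ω < L ω} * P.real {ω | u < U n ω} := by
  have hA' : Measurable fun ω i => A i ω := measurable_pi_lambda _ hA
  have hU' : Measurable fun ω i => U i ω := measurable_pi_lambda _ hU
  have hind : IndepFun (fun ω => (L ω, fun i => A i ω)) (fun ω i => U i ω) P := by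
    have hLA : IndepFun L (fun ω i => A i ω) P := hLAU.comp measurable_id measurable_fst
    rw [indepFun_iff_map_prod_eq_prod_map_map (hL.prodMk hA').aemeasurable hU'.aemeasurable,
      hLA.map_prod_eq_prod_map_map hL.aemeasurable hA'.aemeasurable]
    have := Measure.isProbabilityMeasure_map (μ := P) hL.aemeasurable
    have := Measure.isProbabilityMeasure_map (μ := P) hA'.aemeasurable
    have := Measure.isProbabilityMeasure_map (μ := P) hU'.aemeasurable
    -- Reassociating the triple product law turns independence of `L` from (A, U) into independence
    -- of (L, A) from `U`.
    apply MeasurableEquiv.prodAssoc.map_measurableEquiv_injective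
    rw [Measure.prodAssoc_prod, Measure.map_map (MeasurableEquiv.measurable _)
      ((hL.prodMk hA').prodMk hU'),
      ← hAU.map_prod_eq_prod_map_map hA'.aemeasurable hU'.aemeasurable,
      ← hLAU.map_prod_eq_prod_map_map hL.aemeasurable (hA'.prodMk hU').aemeasurable]
    rfl
  set S : Set (ℝ × (ℕ → ℝ)) := {x | ∀ i < n, x.2 i < x.1} with hS
  have hSm : MeasurableSet S := by
    have : S = ⋂ i, ⋂ (_ : i < n), {x | x.2 i < x.1} := by ext; simp [hS]
    rw [this]
    refine MeasurableSet.iInter fun i => MeasurableSet.iInter fun _ => ?_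
    exact measurableSet_lt ((measurable_pi_apply i).comp measurable_snd) measurable_fst
  have := hind.measure_inter_preimage_eq_mul S {x | u < x n} hSm
    (measurableSet_lt measurable_const (measurable_pi_apply n))
  simp only [measureReal_def, ← ENNReal.toReal_mul]
  exact congrArg ENNReal.toReal this

end Probability

/-! ### Upper and lower bounds for the tail of the total time -/

section TotalTime

variable {Ω : Type*} [MeasurableSpace Ω] {P : Measure Ω} [IsProbabilityMeasure P]

/-- A failed attempt followed by a long unavailable period is negligible. -/
theorem exists_prob_exists_le_rpow {A U : ℕ → Ω → ℝ} {L : Ω → ℝ} (hA : ∀ i, Measurable (A i))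
    (hU : ∀ i, Measurable (U i)) (hL : Measurable L) (hU0 : ∀ᵐ ω ∂P, 0 ≤ U 0 ω)
    (hUid : ∀ i, IdentDistrib (U i) (U 0) P P)
    (hAU : IndepFun (fun ω i => A i ω) (fun ω i => U i ω) P)
    (hLAU : IndepFun L (fun ω => ((fun i => A i ω), (fun i => U i ω))) P)
    {C γ p κ δ : ℝ} (hC : 0 ≤ C) (hγ0 : 0 < γ) (hγ1 : γ < 1) (hp : 0 < p) (hκ : 0 < κ) (hδ : 0 < δ)
    (hb : ∀ n : ℕ, P.real {ω | ∀ i < n, A i ω < L ω} ≤ C * ((n : ℝ) + 1) ^ (-γ))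
    (hmom : Integrable (fun ω => U 0 ω ^ p) P) :
    ∃ D, ∀ t, 0 < t → P.real {ω | ∃ i < ⌊κ * t⌋₊,
      (∀ j < i, A j ω < L ω) ∧ δ * t < U i ω} ≤ D * t ^ (1 - γ - p) := by
  obtain ⟨D, hD, h⟩ := exists_prob_gt_le_rpow hU0 hp hmom hδ
  refine ⟨C * (κ ^ (1 - γ) / (1 - γ)) * D, fun t ht => ?_⟩
  have hset : {ω | ∃ i < ⌊κ * t⌋₊, (∀ j < i, A j ω < L ω) ∧ δ * t < U i ω} =
      ⋃ i ∈ Finset.range ⌊κ * t⌋₊, {ω | (∀ j < i, A j ω < L ω) ∧ δ * t < U i ω} := by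
    ext ω; simp only [mem_iUnion, exists_prop, mem_ofPred_eq, Finset.mem_range]
  have hident : ∀ i, P.real {ω | δ * t < U i ω} = P.real {ω | δ * t < U 0 ω} := fun i =>
    congrArg ENNReal.toReal ((hUid i).measure_mem_eq (s := Ioi (δ * t)) measurableSet_Ioi)
  rw [hset]
  calc _ ≤ ∑ i ∈ Finset.range ⌊κ * t⌋₊, P.real {ω | (∀ j < i, A j ω < L ω) ∧ δ * t < U i ω} :=
        measureReal_biUnion_finset_le _ _
    _ ≤ ∑ i ∈ Finset.range ⌊κ * t⌋₊, C * ((i : ℝ) + 1) ^ (-γ) * (D * t ^ (-p)) := by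
        refine Finset.sum_le_sum fun i _ => ?_
        rw [prob_forall_lt_and_gt hA hU hL hAU hLAU, hident]
        exact mul_le_mul (hb i) (h t ht) measureReal_nonneg (by positivity)
    _ = C * (∑ i ∈ Finset.range ⌊κ * t⌋₊, ((i : ℝ) + 1) ^ (-γ)) * (D * t ^ (-p)) := by
        rw [← Finset.sum_mul, ← Finset.mul_sum]
    _ ≤ C * ((κ * t) ^ (1 - γ) / (1 - γ)) * (D * t ^ (-p)) := by
        have h1 : (⌊κ * t⌋₊ : ℝ) ^ (1 - γ) ≤ (κ * t) ^ (1 - γ) :=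
          Real.rpow_le_rpow (by positivity) (Nat.floor_le (by positivity)) (by linarith)
        have h2 : (0 : ℝ) < 1 - γ := by linarith
        gcongr
        exact (sum_range_rpow_neg_le hγ0 hγ1 _).trans (by gcongr)
    _ = _ := by
        rw [Real.mul_rpow hκ.le ht.le, sub_eq_add_neg (1 - γ) p, Real.rpow_add ht]
        ring

section Bounds

variable {A U : ℕ → Ω → ℝ} {L : Ω → ℝ} {Φ : ℝ → ℝ} {α θ c ε : ℝ}

/-- Upper bound for the tail of the total time. -/
theorem exists_upper_bound (hA : ∀ i, Measurable (A i)) (hU : ∀ i, Measurable (U i))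
    (hL : Measurable L) (hA0 : ∀ i, ∀ᵐ ω ∂P, 0 ≤ A i ω) (hU0 : ∀ i, ∀ᵐ ω ∂P, 0 ≤ U i ω)
    (hL0 : ∀ᵐ ω ∂P, 0 ≤ L ω) (hAind : iIndepFun A P) (hAid : ∀ i, IdentDistrib (A i) (A 0) P P)
    (hUind : iIndepFun U P) (hUid : ∀ i, IdentDistrib (U i) (U 0) P P)
    (hAU : IndepFun (fun ω i => A i ω) (fun ω i => U i ω) P)
    (hLAU : IndepFun L (fun ω => ((fun i => A i ω), (fun i => U i ω))) P)
    (hα : 0 < α) (hΦ : IsRegularlyVarying Φ α) (hθ : 0 < θ)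
    (hUmom : Integrable (fun ω => U 0 ω ^ (max α 1 + θ)) P)
    (hAmom : Integrable (fun ω => A 0 ω ^ (1 + θ)) P)
    (hLmom : Integrable (fun ω => L ω ^ (α + θ)) P)
    (hm : 0 < ∫ ω, A 0 ω ∂P + ∫ ω, U 0 ω ∂P)
    (hb : Tendsto (fun n : ℕ => Φ n * P.real {ω | ∀ i < n, A i ω < L ω}) atTop (𝓝 c))
    (hε : 0 < ε) (hε1 : ε < 1) :
    ∃ f : ℝ → ℝ,
      Tendsto f atTop (𝓝 (c * ((∫ ω, A 0 ω ∂P + ∫ ω, U 0 ω ∂P) / (1 - ε)) ^ α)) ∧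
      ∀ᶠ t : ℝ in atTop, Φ t * P.real {ω | (t : EReal) < totalTime A U L ω} ≤ f t := by
  set mA := ∫ ω, A 0 ω ∂P with hmA
  set mU := ∫ ω, U 0 ω ∂P with hmU
  set θ' := min θ 1 with hθ'
  have hθ'0 : 0 < θ' := lt_min hθ one_pos
  have hθ'1 : θ' ≤ 1 := min_le_right _ _
  have hθ'θ : θ' ≤ θ := min_le_left _ _
  have hUp : 1 + θ ≤ max α 1 + θ := by linarith [le_max_right α 1]
  have hAmom' := integrable_rpow_of_le (hA 0) (hA0 0) (p := 1 + θ') (by linarith) (by linarith) hAmom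
  have hUmom' := integrable_rpow_of_le (hU 0) (hU0 0) (p := 1 + θ') (by linarith) (by linarith) hUmom
  have hAint : Integrable (A 0) P := by
    simpa using integrable_rpow_of_le (hA 0) (hA0 0) (p := 1) (by linarith) (by linarith) hAmom
  have hUint : Integrable (U 0) P := by
    simpa using integrable_rpow_of_le (hU 0) (hU0 0) (p := 1) (by linarith) (by linarith) hUmom
  -- A run of κt attempts has mean length (1 - ε)t. The slack εt is shared: ε/4 for each sum, and δ
  -- ≤ ε/2 for `L`.
  set κ := (1 - ε) / (mA + mU) with hκ
  have hκ0 : 0 < κ := div_pos (by linarith) hm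
  have hκm : κ * (mA + mU) = 1 - ε := div_mul_cancel₀ _ hm.ne'
  obtain ⟨δA, hδA, hAbd⟩ := exists_prob_sum_min_le_rpow hA hA0 hAind hAid hθ'0 hθ'1 hAint hAmom'
    hκ0 (show 0 < ε / 4 by positivity) (show 0 < α + 1 by positivity)
  obtain ⟨δU, hδU, hUbd⟩ := exists_prob_sum_min_le_rpow hU hU0 hUind hUid hθ'0 hθ'1 hUint hUmom'
    hκ0 (show 0 < ε / 4 by positivity) (show 0 < α + 1 by positivity)
  set δ := min (min δA δU) (ε / 2) with hδ
  have hδ0 : 0 < δ := lt_min (lt_min hδA hδU) (by positivity)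
  have hδε : δ ≤ ε / 2 := min_le_right _ _
  obtain ⟨CL, -, hLbd⟩ := exists_prob_gt_le_rpow hL0 (show 0 < α + θ by positivity) hLmom hδ0
  -- Small enough that γ = min(α,1) - η lies in (0, 1) and below α, and that α + θ - η still exceeds
  -- α.
  set η := min (min α 1) θ / 2 with hη
  have hmin0 : 0 < min α 1 := lt_min hα one_pos
  have hη0 : 0 < η := half_pos (lt_min hmin0 hθ)
  have hη1 : η < min α 1 :=
    lt_of_lt_of_le (half_lt_self (lt_min hmin0 hθ)) (min_le_left _ _)
  have hη2 : η < θ := lt_of_lt_of_le (half_lt_self (lt_min hmin0 hθ)) (min_le_right _ _)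
  have hminα : min α 1 ≤ α := min_le_left _ _
  have hmin1 : min α 1 ≤ 1 := min_le_right _ _
  obtain ⟨C, hC0, hC⟩ := hΦ.exists_le_rpow_of_tendsto hb (γ := min α 1 - η) (by linarith)
    (by linarith)
  obtain ⟨D, hD⟩ := exists_prob_exists_le_rpow hA hU hL (hU0 0) hUid hAU hLAU hC0
    (show 0 < min α 1 - η by linarith) (by linarith)
    (show 0 < max α 1 + θ by linarith [le_max_right α 1]) hκ0 hδ0 hC hUmom
  have hexp : 1 - (min α 1 - η) - (max α 1 + θ) = -(α + θ - η) := by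
    linarith [min_add_max α 1]
  rw [hexp] at hD
  have tL := hΦ.tendsto_mul_of_le_rpow (β := α + θ) (by linarith)
    (f := fun t => P.real {ω | δ * t < L ω}) (fun _ => measureReal_nonneg)
    ((eventually_gt_atTop 0).mono hLbd)
  have tD := hΦ.tendsto_mul_of_le_rpow (β := α + θ - η) (by linarith)
    (f := fun t => P.real {ω | ∃ i < ⌊κ * t⌋₊,
      (∀ j < i, A j ω < L ω) ∧ δ * t < U i ω}) (fun _ => measureReal_nonneg)
    ((eventually_gt_atTop 0).mono hD)
  have tA := hΦ.tendsto_mul_of_le_rpow (β := α + 1) (by linarith)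
    (f := fun t => P.real {ω | κ * t * mA + ε / 4 * t ≤
      ∑ i ∈ Finset.range ⌊κ * t⌋₊, min (A i ω) (δ * t)}) (fun _ => measureReal_nonneg)
    (hAbd δ hδ0 ((min_le_left _ _).trans (min_le_left _ _)))
  have tU := hΦ.tendsto_mul_of_le_rpow (β := α + 1) (by linarith)
    (f := fun t => P.real {ω | κ * t * mU + ε / 4 * t ≤
      ∑ i ∈ Finset.range ⌊κ * t⌋₊, min (U i ω) (δ * t)}) (fun _ => measureReal_nonneg)
    (hUbd δ hδ0 ((min_le_left _ _).trans (min_le_right _ _)))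
  have tB := hΦ.tendsto_mul_comp_nat hb (n := fun t => ⌊κ * t⌋₊) hκ0
    (tendsto_nat_floor_mul_div_atTop hκ0.le)
  rw [show κ⁻¹ = (mA + mU) / (1 - ε) from inv_div _ _] at tB
  refine ⟨_, by simpa using (((tB.add tL).add tD).add tA).add tU, ?_⟩
  filter_upwards [hΦ.eventually_pos, eventually_gt_atTop 0] with t ht ht0
  simp only [← mul_add]
  refine mul_le_mul_of_nonneg_left ?_ ht.le
  refine le_trans ?_ ((measureReal_union_le _ _).trans (add_le_add_left
    ((measureReal_union_le _ _).trans (add_le_add_left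
    ((measureReal_union_le _ _).trans (add_le_add_left (measureReal_union_le _ _) _)) _)) _))
  refine ENNReal.toReal_mono (measure_ne_top _ _) (measure_mono_ae ?_)
  filter_upwards [ae_all_iff.2 hA0, ae_all_iff.2 hU0] with ω h1 h2 h3
  have h4 : κ * t * mA + ε / 4 * t + (κ * t * mU + ε / 4 * t) ≤ (1 - δ) * t := by
    have e : κ * t * mA + ε / 4 * t + (κ * t * mU + ε / 4 * t) =
        (κ * (mA + mU) + ε / 2) * t := by ring
    rw [e, hκm]
    exact mul_le_mul_of_nonneg_right (by linarith) ht0.le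
  rcases lt_totalTime_cases h1 h2 ⌊κ * t⌋₊ (mul_pos hδ0 ht0).le h4 h3 with h | h | h | h | h
  · exact Or.inl (Or.inl (Or.inl (Or.inl h)))
  · exact Or.inl (Or.inl (Or.inl (Or.inr h)))
  · exact Or.inl (Or.inl (Or.inr h))
  · exact Or.inl (Or.inr h)
  · exact Or.inr h

/-- Lower bound for the tail of the total time. -/
theorem exists_lower_bound (hA : ∀ i, Measurable (A i)) (hU : ∀ i, Measurable (U i))
    (hA0 : ∀ i, ∀ᵐ ω ∂P, 0 ≤ A i ω) (hU0 : ∀ i, ∀ᵐ ω ∂P, 0 ≤ U i ω)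
    (hL0 : ∀ᵐ ω ∂P, 0 ≤ L ω) (hAind : iIndepFun A P) (hAid : ∀ i, IdentDistrib (A i) (A 0) P P)
    (hUind : iIndepFun U P) (hUid : ∀ i, IdentDistrib (U i) (U 0) P P)
    (hΦ : IsRegularlyVarying Φ α) (hAint : Integrable (A 0) P) (hUint : Integrable (U 0) P)
    (hm : 0 < ∫ ω, A 0 ω ∂P + ∫ ω, U 0 ω ∂P)
    (hb : Tendsto (fun n : ℕ => Φ n * P.real {ω | ∀ i < n, A i ω < L ω}) atTop (𝓝 c))
    (hε : 0 < ε) :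
    ∃ f : ℝ → ℝ,
      Tendsto f atTop (𝓝 (c * ((∫ ω, A 0 ω ∂P + ∫ ω, U 0 ω ∂P) / (1 + ε)) ^ α)) ∧
      ∀ᶠ t : ℝ in atTop, f t ≤ Φ t * P.real {ω | (t : EReal) < totalTime A U L ω} := by
  set mA := ∫ ω, A 0 ω ∂P with hmA
  set mU := ∫ ω, U 0 ω ∂P with hmU
  set κ := (1 + ε) / (mA + mU) with hκ
  have hκ0 : 0 < κ := div_pos (by linarith) hm
  -- Chosen so that, with each mean lowered by e, κt attempts last exactly t.
  set e := (mA + mU) * (ε / (1 + ε)) / 2 with he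
  have he0 : 0 < e := by positivity
  have hκe : 1 = κ * (mA - e + (mU - e)) := by
    have : mA - e + (mU - e) = (mA + mU) * (1 - ε / (1 + ε)) := by rw [he]; ring
    rw [this, hκ]
    field_simp
    ring
  obtain ⟨ρA, hρA, hAbd⟩ := exists_prob_sum_le_exp hA hA0 hAind hAid hAint he0
  obtain ⟨ρU, hρU, hUbd⟩ := exists_prob_sum_le_exp hU hU0 hUind hUid hUint he0
  have key : ∀ {ρ : ℝ} {F : ℕ → ℝ}, 0 < ρ → (∀ n, 0 ≤ F n) → (∀ n : ℕ, F n ≤ Real.exp (-ρ * n)) →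
      Tendsto (fun t => Φ t * F ⌈κ * t⌉₊) atTop (𝓝 0) := by
    intro ρ F hρ hF0 hF
    refine hΦ.tendsto_mul_of_le_rpow (β := α + 1) (C := 1) (by linarith) (fun t => hF0 _) ?_
    have hlit := (isLittleO_exp_neg_mul_rpow_atTop (mul_pos hρ hκ0) (-(α + 1))).bound one_pos
    filter_upwards [hlit, eventually_gt_atTop 0] with t h1 ht
    rw [Real.norm_of_nonneg (Real.exp_pos _).le, Real.norm_of_nonneg (by positivity)] at h1
    refine (hF _).trans (le_trans (Real.exp_le_exp.2 ?_) h1)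
    have := mul_le_mul_of_nonneg_left (Nat.le_ceil (κ * t)) hρ.le
    linarith
  have tA := key hρA (fun _ => measureReal_nonneg) hAbd
  have tU := key hρU (fun _ => measureReal_nonneg) hUbd
  have tB := hΦ.tendsto_mul_comp_nat hb (n := fun t => ⌈κ * t⌉₊) hκ0
    (tendsto_nat_ceil_mul_div_atTop hκ0.le)
  rw [show κ⁻¹ = (mA + mU) / (1 + ε) from inv_div _ _] at tB
  refine ⟨_, by simpa using (tB.sub tA).sub tU, ?_⟩
  filter_upwards [hΦ.eventually_pos, eventually_gt_atTop 0] with t ht ht0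
  simp only [← mul_sub]
  refine mul_le_mul_of_nonneg_left ?_ ht.le
  rw [sub_le_iff_le_add, sub_le_iff_le_add]
  refine le_trans ?_ ((measureReal_union_le _ _).trans (add_le_add_left
    (measureReal_union_le _ _) _))
  refine ENNReal.toReal_mono (measure_ne_top _ _) (measure_mono_ae ?_)
  filter_upwards [ae_all_iff.2 hA0, ae_all_iff.2 hU0, hL0] with ω h1 h2 h3 h4
  by_contra hcon
  have hcon' : ¬ (((t : EReal) < totalTime A U L ω ∨
      ∑ i ∈ Finset.range ⌈κ * t⌉₊, U i ω ≤ (⌈κ * t⌉₊ : ℝ) * (mU - e)) ∨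
      ∑ i ∈ Finset.range ⌈κ * t⌉₊, A i ω ≤ (⌈κ * t⌉₊ : ℝ) * (mA - e)) := hcon
  push Not at hcon'
  obtain ⟨⟨h5, h6⟩, h7⟩ := hcon'
  refine not_lt.2 h5 (lt_totalTime_of_lt_sum h1 h2 h3 h4 ?_)
  have h8 := Nat.le_ceil (κ * t)
  have h9 : 0 < mA - e + (mU - e) := 
    (mul_pos_iff_of_pos_left hκ0).1 (by rw [← hκe]; exact one_pos)
  have h10 := mul_le_mul_of_nonneg_right h8 h9.le
  have h11 : κ * t * (mA - e + (mU - e)) = t := by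
    calc _ = t * (κ * (mA - e + (mU - e))) := by ring
      _ = t := by rw [← hκe, mul_one]
  linarith

end Bounds

end TotalTime

end Retransmission

/-! ### The main theorem: letting ε tend to 0 -/

theorem theorem2p5 {Ω : Type*} [MeasurableSpace Ω] (P : Measure Ω) [IsProbabilityMeasure P]
    (A U : ℕ → Ω → ℝ) (L : Ω → ℝ)
    -- the periods and the data size are non-negative random variables
    (hA_meas : ∀ i, Measurable (A i)) (hU_meas : ∀ i, Measurable (U i)) (hL_meas : Measurable L)
    (hA_nonneg : ∀ i, ∀ᵐ ω ∂P, 0 ≤ A i ω) (hU_nonneg : ∀ i, ∀ᵐ ω ∂P, 0 ≤ U i ω)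
    (hL_nonneg : ∀ᵐ ω ∂P, 0 ≤ L ω)
    -- two mutually independent i.i.d. sequences, independent of the data size
    (hA_indep : iIndepFun A P) (hA_ident : ∀ i, IdentDistrib (A i) (A 0) P P)
    (hU_indep : iIndepFun U P) (hU_ident : ∀ i, IdentDistrib (U i) (U 0) P P)
    (hAU_indep : IndepFun (fun ω i => A i ω) (fun ω i => U i ω) P)
    (hL_indep : IndepFun L (fun ω => ((fun i => A i ω), (fun i => U i ω))) P)
    -- the tail of `L` is continuous, with unbounded support
    (hL_cont : ContinuousOn (Retransmission.ccdf P L) (Ici 0))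
    (hL_supp : ∀ x, 0 ≤ x → 0 < Retransmission.ccdf P L x)
    (Φ : ℝ → ℝ) (α : ℝ) (hα : 0 < α) (hΦ : Retransmission.IsRegularlyVarying Φ α)
    (hΦ_equiv : Tendsto
      (fun x => (Retransmission.ccdf P L x)⁻¹ / Φ ((Retransmission.ccdf P (A 0) x)⁻¹))
      atTop (𝓝 1))
    (θ : ℝ) (hθ : 0 < θ)
    (hU_mom : Integrable (fun ω => U 0 ω ^ (max α 1 + θ)) P)
    (hA_mom : Integrable (fun ω => A 0 ω ^ (1 + θ)) P)
    (hL_mom : Integrable (fun ω => L ω ^ (α + θ)) P) :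
    Tendsto
      (fun t : ℝ => P.real {ω | (t : EReal) < Retransmission.totalTime A U L ω} /
        (Real.Gamma (α + 1) * (∫ ω, (U 0 ω + A 0 ω) ∂P) ^ α / Φ t))
      atTop (𝓝 1) := by
  have hX_supp := Retransmission.ccdf_pos_of_equiv hL_meas hL_supp hΦ_equiv
  have hLA_indep : IndepFun L (fun ω i => A i ω) P := hL_indep.comp measurable_id measurable_fst
  have hanti : Antitone fun l => P.real {ω | l ≤ A 0 ω} := fun a b hab =>
    measureReal_mono fun ω hω => le_trans hab hω
  have hfail : Tendsto (fun n : ℕ => Φ n * P.real {ω | ∀ i < n, A i ω < L ω}) atTop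
      (𝓝 (Real.Gamma (α + 1))) := by
    simp only [Retransmission.prob_forall_lt_eq_integral hA_meas hL_meas hA_indep hA_ident
      hLA_indep]
    refine Retransmission.tendsto_mul_integral_one_sub_pow (hanti.measurable.comp hL_meas)
      (fun ω => (hX_supp (L ω)).trans_le ?_) (fun ω => measureReal_le_one) hα hΦ
      (Retransmission.tendsto_mul_prob_le (hA_meas 0) hL_cont hL_supp hα hΦ hX_supp hΦ_equiv)
    exact measureReal_mono fun ω' hω' => le_of_lt (show L ω < A 0 ω' from hω')
  have hA_int : Integrable (A 0) P := by
    simpa using Retransmission.integrable_rpow_of_le (hA_meas 0) (hA_nonneg 0) (p := 1)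
      (by linarith) (by linarith) hA_mom
  have hU_int : Integrable (U 0) P := by
    simpa using Retransmission.integrable_rpow_of_le (hU_meas 0) (hU_nonneg 0) (p := 1)
      (by linarith) (by linarith [le_max_right α 1]) hU_mom
  have hmean : 0 < ∫ ω, A 0 ω ∂P + ∫ ω, U 0 ω ∂P := by
    refine add_pos_of_pos_of_nonneg ?_ (integral_nonneg_of_ae (hU_nonneg 0))
    rw [integral_pos_iff_support_of_nonneg_ae (hA_nonneg 0) hA_int]
    refine lt_of_lt_of_le (ENNReal.toReal_pos_iff.1 (hX_supp 0)).1 (measure_mono fun ω hω => ?_)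
    exact ne_of_gt (show 0 < A 0 ω from hω)
  rw [show ∫ ω, (U 0 ω + A 0 ω) ∂P = ∫ ω, A 0 ω ∂P + ∫ ω, U 0 ω ∂P by
    rw [integral_add hU_int hA_int, add_comm]]
  set m := ∫ ω, A 0 ω ∂P + ∫ ω, U 0 ω ∂P with hm
  have hΓ : 0 < Real.Gamma (α + 1) := Real.Gamma_pos_of_pos (by linarith)
  -- The sign σ = 1 serves the lower bound and σ = -1 the upper bound.
  have hcont : ∀ σ : ℝ, ContinuousAt
      (fun ε : ℝ => Real.Gamma (α + 1) * (m / (1 + σ * ε)) ^ α) 0 := by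
    intro σ
    refine continuousAt_const.mul (ContinuousAt.rpow_const ?_ (Or.inr hα.le))
    exact continuousAt_const.div (by fun_prop) (by simp)
  have hmain : Tendsto (fun t : ℝ => Φ t *
      P.real {ω | (t : EReal) < Retransmission.totalTime A U L ω}) atTop
      (𝓝 (Real.Gamma (α + 1) * m ^ α)) := by
    refine tendsto_order.2 ⟨fun a ha => ?_, fun b hb => ?_⟩
    · have h1 : ∀ᶠ ε in 𝓝[>] (0 : ℝ), a < Real.Gamma (α + 1) * (m / (1 + 1 * ε)) ^ α :=
        nhdsWithin_le_nhds ((hcont 1).eventually_const_lt (by simpa using ha))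
      obtain ⟨ε, h2, h3⟩ := (h1.and self_mem_nhdsWithin).exists
      obtain ⟨f, h4, h5⟩ := Retransmission.exists_lower_bound hA_meas hU_meas hA_nonneg hU_nonneg
        hL_nonneg hA_indep hA_ident hU_indep hU_ident hΦ hA_int hU_int hmean hfail h3
      rw [one_mul] at h2
      filter_upwards [h4.eventually_const_lt h2, h5] with t h6 h7 using h6.trans_le h7
    · have h1 : ∀ᶠ ε in 𝓝[>] (0 : ℝ), Real.Gamma (α + 1) * (m / (1 + -1 * ε)) ^ α < b :=
        nhdsWithin_le_nhds ((hcont (-1)).eventually_lt_const (by simpa using hb))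
      obtain ⟨ε, h2, h3⟩ := (h1.and (Ioo_mem_nhdsGT (zero_lt_one' ℝ))).exists
      obtain ⟨f, h4, h5⟩ := Retransmission.exists_upper_bound hA_meas hU_meas hL_meas hA_nonneg
        hU_nonneg hL_nonneg hA_indep hA_ident hU_indep hU_ident hAU_indep hL_indep hα hΦ hθ hU_mom
        hA_mom hL_mom hmean hfail h3.1 h3.2
      rw [neg_one_mul, ← sub_eq_add_neg] at h2
      filter_upwards [h4.eventually_lt_const h2, h5] with t h6 h7 using h7.trans_lt h6
  have hpos : 0 < Real.Gamma (α + 1) * m ^ α := mul_pos hΓ (Real.rpow_pos_of_pos hmean α)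
  have hlim := hmain.div_const (Real.Gamma (α + 1) * m ^ α)
  rw [div_self hpos.ne'] at hlim
  refine hlim.congr fun t => ?_
  rw [div_div_eq_mul_div, mul_comm]
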